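/- **Notation.** For a group $G$, a subgroup $\Gamma$ and a submonoid $\Delta$ with $\Gamma\subseteq\Delta\subseteq G$ and $\Delta$ contained in the commensurator of $\Gamma$, the Hecke ring with respect to $(\Gamma,\Delta)$ is the free abelian group on the double cosets $\Gamma\alpha\Gamma$ ($\alpha\in\Delta$) with the product $$(\Gamma\alpha\Gamma)(\Gamma\beta\Gamma)=\sum_{\Gamma\xi\Gamma\in\Gamma\backslash\Delta/\Gamma}\bigl|\{\Gamma\gamma\in\Gamma\backslash\Gamma\beta\Gamma : \xi\gamma^{-1}\in\Gamma\alpha\Gamma\}\bigr|\;\Gamma\xi\Gamma .$$ Let $\mathcal H=L_2/[L_2,[L_2,L_2]]$ be the Heisenberg Lie algebra over $\mathbb Z$, where $L_2$ is the free Lie algebra over $\mathbb Z$ on two generators. Automorphisms act from the right. Put $$\Gamma=\mathrm{Aut}_{\mathbb Z}(\mathcal H),\qquad \Delta=\mathrm{End}_{\mathbb Z}(\mathcal H)\cap \mathrm{Aut}_{\mathbb Q}(\mathcal H\otimes\mathbb Q),$$ and for each prime $p$ $$\Gamma_p=\mathrm{Aut}_{\mathbb Z_p}(\mathcal H\otimes\mathbb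 Z_p),\qquad \Delta_p=\mathrm{End}_{\mathbb Z_p}(\mathcal H\otimes\mathbb Z_p)\cap \mathrm{Aut}_{\mathbb Q_p}(\mathcal H\otimes\mathbb Q_p),$$ where all endomorphisms and automorphisms are those of Lie algebras. Let $\widehat\Gamma=\prod_p\Gamma_p$, and let $\widehat\Delta$ be the set of $(\alpha_p)_p\in\prod_p\Delta_p$ with $\alpha_p\in\Gamma_p$ for almost all $p$. Let $R_{\mathcal H}$, $R_{\mathcal H_p}$ and $\widehat R_{\mathcal H}$ be the Hecke rings with respect to $(\Gamma,\Delta)$, $(\Gamma_p,\Delta_p)$ and $(\widehat\Gamma,\widehat\Delta)$. Let $\iota_p:R_{\mathcal H_p}\to\widehat R_{\mathcal H}$ be the additive map $\Gamma_p\alpha\Gamma_p\mapsto\widehat\Gamma\alpha\widehat\Gamma$ given by the inclusion $\Delta_p\subseteq\widehat\Delta$ (with component $1$ at all primes other than $p$). Let $\eta:\Delta\to\widehat\Delta$ be the diagonal embedding, and let $\eta_{\mathcal H}^*:\widehat R_{\mathcal H}\to R_{\mathcal H}$ be the additive map $$\widehat\Gamma\widehat\alpha\widehat\Gamma\;\mapsto\;\sum_{\Gamma\beta\Gamma\,\in\,\Gamma\backslash\eta^{-1}(\widehat\Gamma\widehat\alpha\widehat\Gamma)/\Gamma}\Gamma\beta\Gamma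 .$$ **Theorem.** 1. For each prime $p$, the map $\eta_{\mathcal H}^*\circ\iota_p:R_{\mathcal H_p}\to R_{\mathcal H}$ is an injective (unital) ring homomorphism. 2. The images of the local Hecke rings commute with each other in $R_{\mathcal H}$: for distinct primes $p\neq q$, every element of the image of $R_{\mathcal H_p}$ commutes with every element of the image of $R_{\mathcal H_q}$. 3. $R_{\mathcal H}$ is not generated as a ring by the images of the local Hecke rings $R_{\mathcal H_p}$, where $p$ runs over all primes. -/

import Mathlib

open scoped TensorProduct Pointwise

noncomputable section

namespace HeckePair

variable {G : Type*} [Group G]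

/-- The set `H \ G` of cosets `H g`. -/
abbrev Cosets (H : Subgroup G) : Type _ := Quotient (QuotientGroup.rightRel H)

/-- The convolution `(φ * ψ)(ξ) = ∑_{Hγ ∈ H \ G} φ(ξ γ⁻¹) ψ(γ)`. -/
def conv (H : Subgroup G) (φ ψ : G → ℤ) (ξ : G) : ℤ :=
  ∑ᶠ c : Cosets H, φ (ξ * c.out⁻¹) * ψ c.out

/-- `H`-bi-invariant functions supported on finitely many cosets `H g`, all contained in `Δ`. -/
structure IsHeckeFun (Δ : Submonoid G) (H : Subgroup G) (φ : G → ℤ) : Prop where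
  left_inv : ∀ a ∈ H, ∀ x, φ (a * x) = φ x
  right_inv : ∀ a ∈ H, ∀ x, φ (x * a) = φ x
  finite : {c : Cosets H | φ c.out ≠ 0}.Finite
  supp : ∀ x, φ x ≠ 0 → x ∈ Δ

variable {Δ : Submonoid G} {H : Subgroup G}

lemma out_mk (H : Subgroup G) (x : G) :
    ∃ a ∈ H, (Quotient.mk (QuotientGroup.rightRel H) x).out = a * x := by
  have h := Quotient.exact (Quotient.out_eq (Quotient.mk (QuotientGroup.rightRel H) x))
  have h' := QuotientGroup.rightRel_apply.1 h
  refine ⟨_, H.inv_mem h', ?_⟩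
  group

lemma mk_mul (a : G) (ha : a ∈ H) (x : G) :
    Quotient.mk (QuotientGroup.rightRel H) (a * x) = Quotient.mk (QuotientGroup.rightRel H) x := by
  apply Quotient.sound
  refine QuotientGroup.rightRel_apply.2 ?_
  simpa using H.inv_mem ha

/-- Right translation of cosets, `H x ↦ H x g`. -/
def translate (H : Subgroup G) (g : G) : Cosets H ≃ Cosets H where
  toFun := Quotient.map (· * g) (by
    intro x y h
    have h' := QuotientGroup.rightRel_apply.1 h
    exact QuotientGroup.rightRel_apply.2 (by simpa [mul_assoc] using h'))
  invFun := Quotient.map (· * g⁻¹) (by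
    intro x y h
    have h' := QuotientGroup.rightRel_apply.1 h
    exact QuotientGroup.rightRel_apply.2 (by simpa [mul_assoc] using h'))
  left_inv := by rintro ⟨x⟩; exact congrArg (Quotient.mk _) (by simp)
  right_inv := by rintro ⟨x⟩; exact congrArg (Quotient.mk _) (by simp)

lemma translate_out (H : Subgroup G) (g : G) (c : Cosets H) :
    ∃ a ∈ H, (translate H g c).out = a * (c.out * g) := by
  have : translate H g c = Quotient.mk (QuotientGroup.rightRel H) (c.out * g) := by
    conv_lhs => rw [← Quotient.out_eq c]
    rfl
  rw [this]
  exact out_mk H _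

namespace IsHeckeFun

variable {φ ψ χ : G → ℤ}

lemma out_eq (hφ : IsHeckeFun Δ H φ) (x : G) :
    φ (Quotient.mk (QuotientGroup.rightRel H) x).out = φ x := by
  obtain ⟨a, ha, h⟩ := out_mk H x
  rw [h, hφ.left_inv a ha]

lemma mul_inv_left (φ : G → ℤ) (a ξ x : G) :
    φ (ξ * (a * x)⁻¹) = φ (ξ * x⁻¹ * a⁻¹) := by
  congr 1; group

/-- The summands of a convolution only depend on the coset. -/
lemma summand_eq (hφ : IsHeckeFun Δ H φ) (hψ : IsHeckeFun Δ H ψ) {a : G} (ha : a ∈ H) (ξ x : G) :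
    φ (ξ * (a * x)⁻¹) * ψ (a * x) = φ (ξ * x⁻¹) * ψ x := by
  rw [hψ.left_inv a ha, mul_inv_left φ, hφ.right_inv _ (H.inv_mem ha)]

lemma finite_conv_summand (hψ : IsHeckeFun Δ H ψ) (φ : G → ℤ) (ξ : G) :
    (Function.support fun c : Cosets H => φ (ξ * c.out⁻¹) * ψ c.out).Finite :=
  hψ.finite.subset fun c hc => by
    simp only [Function.mem_support] at hc
    exact right_ne_zero_of_mul hc

lemma conv_eq_sum (hψ : IsHeckeFun Δ H ψ) (φ : G → ℤ) (ξ : G) :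
    conv H φ ψ ξ = ∑ c ∈ hψ.finite.toFinset, φ (ξ * c.out⁻¹) * ψ c.out := by
  apply finsum_eq_sum_of_support_subset
  intro c hc
  simp only [Function.mem_support] at hc
  simpa using right_ne_zero_of_mul hc

lemma exists_of_conv_ne_zero {ξ : G} (h : conv H φ ψ ξ ≠ 0) :
    ∃ c : Cosets H, φ (ξ * c.out⁻¹) ≠ 0 ∧ ψ c.out ≠ 0 := by
  by_contra! h'
  apply h
  have : ∀ c : Cosets H, φ (ξ * c.out⁻¹) * ψ c.out = 0 := fun c => by
    by_cases h1 : φ (ξ * c.out⁻¹) = 0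
    · simp [h1]
    · simp [h' c h1]
  simp [conv, this]

lemma conv_mem (hφ : IsHeckeFun Δ H φ) (hψ : IsHeckeFun Δ H ψ) : IsHeckeFun Δ H (conv H φ ψ) where
  left_inv a ha x := by
    simp only [conv, mul_assoc, hφ.left_inv a ha]
  right_inv a ha x := by
    unfold conv
    rw [← finsum_comp_equiv (translate H a)]
    refine finsum_congr fun c => ?_
    obtain ⟨b, hb, h⟩ := translate_out H a c
    rw [h, hφ.summand_eq hψ hb, hψ.right_inv a ha]
    congr 2
    group
  finite := by
    refine ((hφ.finite.prod hψ.finite).image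
      (fun q => Quotient.mk (QuotientGroup.rightRel H) (q.1.out * q.2.out))).subset ?_
    intro e he
    obtain ⟨c, h1, h2⟩ := exists_of_conv_ne_zero he
    refine ⟨(Quotient.mk _ (e.out * c.out⁻¹), c), ⟨?_, h2⟩, ?_⟩
    · show φ _ ≠ 0
      rwa [hφ.out_eq]
    · obtain ⟨a, ha, h⟩ := out_mk H (e.out * c.out⁻¹)
      simp only [h]
      conv_rhs => rw [← Quotient.out_eq e]
      rw [← mk_mul a ha e.out]
      congr 1
      group
  supp x hx := by
    obtain ⟨c, h1, h2⟩ := exists_of_conv_ne_zero hx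
    simpa using Δ.mul_mem (hφ.supp _ h1) (hψ.supp _ h2)

lemma conv_assoc (hφ : IsHeckeFun Δ H φ) (hψ : IsHeckeFun Δ H ψ) (hχ : IsHeckeFun Δ H χ) :
    conv H (conv H φ ψ) χ = conv H φ (conv H ψ χ) := by
  funext ξ
  have hR : conv H φ (conv H ψ χ) ξ = ∑ᶠ e : Cosets H, ∑ c ∈ hχ.finite.toFinset,
      φ (ξ * e.out⁻¹) * ψ (e.out * c.out⁻¹) * χ c.out := by
    refine finsum_congr fun e => ?_
    rw [hχ.conv_eq_sum, Finset.mul_sum]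
    exact Finset.sum_congr rfl fun c _ => by ring
  rw [hχ.conv_eq_sum, hR, finsum_sum_comm]
  · refine Finset.sum_congr rfl fun c _ => ?_
    rw [← finsum_mul, ← finsum_comp_equiv (translate H c.out)]
    · congr 1
      refine finsum_congr fun d => ?_
      obtain ⟨b, hb, h⟩ := translate_out H c.out d
      rw [h, mul_inv_left φ, hφ.right_inv _ (H.inv_mem hb)]
      rw [show b * (d.out * c.out) * c.out⁻¹ = b * d.out by group, hψ.left_inv b hb]
      congr 2
      group
  · intro c _
    refine (hψ.finite.preimage (translate H c.out⁻¹).injective.injOn).subset ?_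
    intro e he
    obtain ⟨b, hb, h⟩ := translate_out H c.out⁻¹ e
    show ψ _ ≠ 0
    rw [h, hψ.left_inv b hb]
    exact right_ne_zero_of_mul (left_ne_zero_of_mul he)

lemma conv_add (φ : G → ℤ) (hψ : IsHeckeFun Δ H ψ) (hχ : IsHeckeFun Δ H χ) :
    conv H φ (ψ + χ) = conv H φ ψ + conv H φ χ := by
  funext ξ
  simp only [conv, Pi.add_apply, mul_add]
  exact finsum_add_distrib (hψ.finite_conv_summand φ ξ) (hχ.finite_conv_summand φ ξ)

lemma add_conv (φ ψ : G → ℤ) (hχ : IsHeckeFun Δ H χ) :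
    conv H (φ + ψ) χ = conv H φ χ + conv H ψ χ := by
  funext ξ
  simp only [conv, Pi.add_apply, add_mul]
  exact finsum_add_distrib (hχ.finite_conv_summand φ ξ) (hχ.finite_conv_summand ψ ξ)

end IsHeckeFun

/-- An element of the Hecke module as a function on `G`, extended by zero outside `Δ`. -/
def toFun (f : HeckeRing Δ H ℤ) (x : G) : ℤ :=
  open Classical in if h : x ∈ Δ then f (HeckeCoset.mk H H ⟨x, h⟩) else 0

lemma toFun_coe (f : HeckeRing Δ H ℤ) (x : Δ) : toFun f x = f (HeckeCoset.mk H H x) := by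
  simp [toFun]

lemma mk_eq_mk {x y : Δ} : HeckeCoset.mk H H x = HeckeCoset.mk H H y ↔
    ∃ a ∈ H, ∃ b ∈ H, (y : G) = a * x * b :=
  Quotient.eq.trans DoubleCoset.rel_iff

/-- A double coset `H β H` with `β` in the commensurator of `H` is a finite union of cosets
`H g`. -/
lemma finite_cosets {β : G} (hβ : β ∈ Subgroup.Commensurable.commensurator H) :
    {c : Cosets H | ∃ a ∈ H, ∃ b ∈ H, c.out = a * β * b}.Finite := by
  have h1 := (Subgroup.Commensurable.commensurator_mem_iff H β⁻¹).1
    ((Subgroup.Commensurable.commensurator H).inv_mem hβ)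
  have hfi : ((ConjAct.toConjAct β⁻¹ • H).subgroupOf H).FiniteIndex := ⟨h1.1⟩
  have hfin : Finite (H ⧸ (ConjAct.toConjAct β⁻¹ • H).subgroupOf H) :=
    Subgroup.finite_quotient_of_finiteIndex
  let F : (H ⧸ (ConjAct.toConjAct β⁻¹ • H).subgroupOf H) → Cosets H :=
    Quotient.lift (fun b : H => Quotient.mk (QuotientGroup.rightRel H) (β * (b : G)⁻¹)) (by
      intro x y hxy
      have h2 := QuotientGroup.leftRel_apply.1 hxy
      rw [Subgroup.mem_subgroupOf, Subgroup.mem_pointwise_smul_iff_inv_smul_mem] at h2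
      have h3 := H.inv_mem h2
      refine Quotient.sound (QuotientGroup.rightRel_apply.2 ?_)
      simp only [ConjAct.smul_def, ← ConjAct.toConjAct_inv, ConjAct.ofConjAct_toConjAct] at h3
      simpa [mul_assoc] using h3)
  refine (Set.finite_range F).subset ?_
  rintro c ⟨a, ha, b, hb, h⟩
  refine ⟨Quotient.mk _ ⟨b⁻¹, H.inv_mem hb⟩, ?_⟩
  rw [← Quotient.out_eq c, h, mul_assoc, mk_mul a ha]
  show Quotient.mk _ (β * (b⁻¹)⁻¹) = _
  rw [inv_inv]

/-- A bi-invariant function as a finite formal sum of double cosets. -/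
def ofFun (φ : G → ℤ) (hφ : IsHeckeFun Δ H φ) : HeckeRing Δ H ℤ :=
  HeckeCosetModule.of <| Finsupp.ofSupportFinite
    (fun D : HeckeCoset Δ H H => φ ((Quotient.out D : Δ) : G)) (by
      refine Set.Finite.of_finite_image (f := fun D : HeckeCoset Δ H H =>
        Quotient.mk (QuotientGroup.rightRel H) ((Quotient.out D : Δ) : G)) ?_ ?_
      · refine hφ.finite.subset ?_
        rintro _ ⟨D, hD, rfl⟩
        show φ _ ≠ 0
        rw [hφ.out_eq]
        exact hD
      · intro D _ E _ h
        rw [← Quotient.out_eq D, ← Quotient.out_eq E]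
        have h' := QuotientGroup.rightRel_apply.1 (Quotient.exact h)
        exact mk_eq_mk.2 ⟨_, h', 1, H.one_mem, by simp⟩)

lemma ofFun_mk (φ : G → ℤ) (hφ : IsHeckeFun Δ H φ) (x : Δ) :
    ofFun φ hφ (HeckeCoset.mk H H x) = φ x := by
  obtain ⟨a, ha, b, hb, h⟩ := mk_eq_mk.1 (Quotient.out_eq (HeckeCoset.mk H H x)).symm
  show φ _ = φ x
  rw [h, hφ.right_inv b hb, hφ.left_inv a ha]

lemma toFun_ofFun (φ : G → ℤ) (hφ : IsHeckeFun Δ H φ) : toFun (ofFun φ hφ) = φ := by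
  funext x
  by_cases hx : x ∈ Δ
  · exact (toFun_coe (ofFun φ hφ) ⟨x, hx⟩).trans (ofFun_mk φ hφ ⟨x, hx⟩)
  · have : φ x = 0 := by
      by_contra h
      exact hx (hφ.supp x h)
    simp [toFun, hx, this]

lemma toFun_injective : Function.Injective (toFun : HeckeRing Δ H ℤ → G → ℤ) := by
  intro f g h
  refine HeckeCosetModule.ext fun D => ?_
  obtain ⟨x, rfl⟩ := Quotient.exists_rep D
  exact (toFun_coe f x).symm.trans ((congrFun h x).trans (toFun_coe g x))

lemma toFun_add (f g : HeckeRing Δ H ℤ) : toFun (f + g) = toFun f + toFun g := by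
  funext x
  by_cases hx : x ∈ Δ
  · simp only [toFun, hx, dite_true, Pi.add_apply]
    rfl
  · simp [toFun, hx]

lemma toFun_zero : toFun (0 : HeckeRing Δ H ℤ) = fun _ => 0 := by
  funext x
  by_cases hx : x ∈ Δ
  · simp only [toFun, hx, dite_true]
    rfl
  · simp [toFun, hx]

section Ring

variable [IsHeckeTriple Δ H H]

lemma isHeckeFun_toFun (f : HeckeRing Δ H ℤ) : IsHeckeFun Δ H (toFun f) := by
  have hH : ∀ a ∈ H, a ∈ Δ := fun a ha => IsHeckeTriple.mem_of_mem_left H ha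
  have key : ∀ a ∈ H, ∀ b ∈ H, ∀ x, toFun f (a * x * b) = toFun f x := by
    intro a ha b hb x
    by_cases hx : x ∈ Δ
    · have hx' : a * x * b ∈ Δ := Δ.mul_mem (Δ.mul_mem (hH a ha) hx) (hH b hb)
      simp only [toFun, hx, hx', dite_true]
      congr 1
      exact (mk_eq_mk.2 ⟨a, ha, b, hb, rfl⟩).symm
    · have hx' : a * x * b ∉ Δ := fun h => hx (by
        simpa [mul_assoc] using
          Δ.mul_mem (Δ.mul_mem (hH _ (H.inv_mem ha)) h) (hH _ (H.inv_mem hb)))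
      simp [toFun, hx, hx']
  refine ⟨fun a ha x => by simpa using key a ha 1 H.one_mem x,
    fun a ha x => by simpa using key 1 H.one_mem a ha x, ?_, ?_⟩
  · have : (⋃ D ∈ {D : HeckeCoset Δ H H | f D ≠ 0},
        {c : Cosets H | ∃ a ∈ H, ∃ b ∈ H, c.out = a * ((Quotient.out D : Δ) : G) * b}).Finite := by
      refine Set.Finite.biUnion (HeckeCosetModule.of.symm f).hasFiniteSupport fun D _ => ?_
      exact finite_cosets (IsHeckeTriple.mem_commensurator_right H (Quotient.out D : Δ))
    refine this.subset fun c hc => ?_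
    have hΔ : c.out ∈ Δ := by
      by_contra h
      exact hc (by simp [toFun, h])
    have hne : f (HeckeCoset.mk H H ⟨c.out, hΔ⟩) ≠ 0 := by
      simpa [toFun, hΔ] using hc
    refine Set.mem_biUnion hne ?_
    exact mk_eq_mk.1 (Quotient.out_eq (HeckeCoset.mk H H ⟨c.out, hΔ⟩))
  · intro x hx
    by_contra h
    exact hx (by simp [toFun, h])

/-- The product of the Hecke ring: the coefficient of `HξH` in `f * g` is
`∑_{Hγ ∈ H \ G} f(H ξγ⁻¹ H) g(H γ H)`, a term being zero if `ξγ⁻¹` or `γ` is not in `Δ`.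
This is the bilinear extension of
`HαH * HβH = ∑_ξ #{Hγ ⊆ HβH | ξγ⁻¹ ∈ HαH} HξH`; see `basis_mul_basis`. -/
instance instMul : Mul (HeckeRing Δ H ℤ) where
  mul f g := ofFun (conv H (toFun f) (toFun g)) ((isHeckeFun_toFun f).conv_mem (isHeckeFun_toFun g))

/-- The identity of the Hecke ring is the double coset `H1H = H`. -/
instance instOne : One (HeckeRing Δ H ℤ) where
  one := HeckeCosetModule.of (Finsupp.single 1 1)

lemma toFun_mul (f g : HeckeRing Δ H ℤ) : toFun (f * g) = conv H (toFun f) (toFun g) :=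
  toFun_ofFun _ _

/-- The double coset `HαH` as an element of the Hecke ring. -/
def basis (H : Subgroup G) (α : Δ) : HeckeRing Δ H ℤ :=
  HeckeCosetModule.of (Finsupp.single (HeckeCoset.mk H H α) 1)

open Classical in
lemma toFun_basis (α : Δ) (x : G) :
    toFun (basis H α) x = if x ∈ DoubleCoset.doubleCoset (α : G) H H then 1 else 0 := by
  by_cases hx : x ∈ Δ
  · rw [toFun_coe (basis H α) ⟨x, hx⟩]
    have : HeckeCoset.mk H H α = HeckeCoset.mk H H ⟨x, hx⟩ ↔
        x ∈ DoubleCoset.doubleCoset (α : G) H H := mk_eq_mk.trans DoubleCoset.mem_doubleCoset.symm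
    show (Finsupp.single (HeckeCoset.mk H H α) (1 : ℤ)) (HeckeCoset.mk H H ⟨x, hx⟩) = _
    rw [Finsupp.single_apply, if_congr this rfl rfl]
  · have : x ∉ DoubleCoset.doubleCoset (α : G) H H := by
      rw [DoubleCoset.mem_doubleCoset]
      rintro ⟨a, ha, b, hb, rfl⟩
      exact hx (Δ.mul_mem (Δ.mul_mem (IsHeckeTriple.mem_of_mem_left H ha) α.2)
        (IsHeckeTriple.mem_of_mem_left H hb))
    simp [toFun, hx, this]

open Classical in
lemma toFun_one (x : G) : toFun (1 : HeckeRing Δ H ℤ) x = if x ∈ H then 1 else 0 := by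
  refine (toFun_basis (1 : Δ) x).trans (if_congr ?_ rfl rfl)
  rw [DoubleCoset.mem_doubleCoset]
  constructor
  · rintro ⟨a, ha, b, hb, rfl⟩
    simpa using H.mul_mem ha hb
  · intro hx
    exact ⟨x, hx, 1, H.one_mem, by simp⟩

lemma conv_one (f : HeckeRing Δ H ℤ) :
    conv H (toFun f) (toFun (1 : HeckeRing Δ H ℤ)) = toFun f := by
  classical
  funext ξ
  unfold conv
  rw [finsum_eq_single _ (Quotient.mk (QuotientGroup.rightRel H) 1)]
  · obtain ⟨a, ha, h⟩ := out_mk H 1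
    rw [h, (isHeckeFun_toFun f).summand_eq (isHeckeFun_toFun 1) ha]
    simp [toFun_one, H.one_mem]
  · intro c hc
    have : c.out ∉ H := fun h => hc (by
      have := mk_mul c.out h 1
      rwa [mul_one, Quotient.out_eq] at this)
    simp [toFun_one, this]

lemma one_conv (f : HeckeRing Δ H ℤ) :
    conv H (toFun (1 : HeckeRing Δ H ℤ)) (toFun f) = toFun f := by
  classical
  funext ξ
  unfold conv
  rw [finsum_eq_single _ (Quotient.mk (QuotientGroup.rightRel H) ξ)]
  · obtain ⟨a, ha, h⟩ := out_mk H ξ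
    rw [h, (isHeckeFun_toFun 1).summand_eq (isHeckeFun_toFun f) ha]
    simp [toFun_one, H.one_mem]
  · intro c hc
    have : ξ * c.out⁻¹ ∉ H := fun h => hc (by
      have := mk_mul _ h c.out
      rw [inv_mul_cancel_right, Quotient.out_eq] at this
      exact this.symm)
    simp [toFun_one, this]

instance instRing : Ring (HeckeRing Δ H ℤ) :=
  { (inferInstance : AddCommGroup (HeckeRing Δ H ℤ)), instMul, instOne with
    left_distrib := fun f g h => toFun_injective (by
      simp only [toFun_mul, toFun_add]
      exact IsHeckeFun.conv_add _ (isHeckeFun_toFun g) (isHeckeFun_toFun h))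
    right_distrib := fun f g h => toFun_injective (by
      simp only [toFun_mul, toFun_add]
      exact IsHeckeFun.add_conv _ _ (isHeckeFun_toFun h))
    zero_mul := fun f => toFun_injective (by
      rw [toFun_mul, toFun_zero]
      funext ξ
      simp [conv])
    mul_zero := fun f => toFun_injective (by
      rw [toFun_mul, toFun_zero]
      funext ξ
      simp [conv])
    mul_assoc := fun f g h => toFun_injective (by
      simp only [toFun_mul]
      exact (isHeckeFun_toFun f).conv_assoc (isHeckeFun_toFun g) (isHeckeFun_toFun h))
    one_mul := fun f => toFun_injective (by rw [toFun_mul, one_conv])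
    mul_one := fun f => toFun_injective (by rw [toFun_mul, conv_one]) }

/-- The structure constants of the Hecke ring. -/
lemma basis_mul_basis (α β ξ : Δ) :
    (basis H α * basis H β) (HeckeCoset.mk H H ξ) =
      Nat.card {c : Cosets H // c.out ∈ DoubleCoset.doubleCoset (β : G) H H ∧
        (ξ : G) * c.out⁻¹ ∈ DoubleCoset.doubleCoset (α : G) H H} := by
  classical
  rw [← toFun_coe, toFun_mul]
  unfold conv
  rw [finsum_congr (g := fun c : Cosets H =>
    if c.out ∈ DoubleCoset.doubleCoset (β : G) H H ∧
        (ξ : G) * c.out⁻¹ ∈ DoubleCoset.doubleCoset (α : G) H H then (1 : ℤ) else 0)]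
  · have hfin : {c : Cosets H | c.out ∈ DoubleCoset.doubleCoset (β : G) H H ∧
        (ξ : G) * c.out⁻¹ ∈ DoubleCoset.doubleCoset (α : G) H H}.Finite := by
      refine (isHeckeFun_toFun (basis H β)).finite.subset fun c hc => ?_
      show toFun _ _ ≠ 0
      rw [toFun_basis, if_pos hc.1]
      exact one_ne_zero
    rw [finsum_eq_sum_of_support_subset (s := hfin.toFinset)]
    · rw [Finset.sum_ite_of_true (by intro c hc; simpa using hc)]
      simp only [Finset.sum_const, nsmul_eq_mul, mul_one, Nat.cast_inj]
      exact (Nat.card_eq_card_finite_toFinset hfin).symm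
    · intro c hc
      simpa using hc
  · intro c
    rw [toFun_basis, toFun_basis]
    by_cases h1 : c.out ∈ DoubleCoset.doubleCoset (β : G) H H <;>
    by_cases h2 : (ξ : G) * c.out⁻¹ ∈ DoubleCoset.doubleCoset (α : G) H H <;> simp [h1, h2]

end Ring

end HeckePair

/-- The automorphism group of a Lie algebra `V` over `K`, acting on `V` from the right:
`x ^ (g h) = (x ^ g) ^ h`, i.e. products are compositions read from left to right. -/
structure LieAut (K V : Type*) [CommRing K] [LieRing V] [LieAlgebra K V] where
  /-- The underlying automorphism. -/
  toLieEquiv : V ≃ₗ⁅K⁆ V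

namespace LieAut

section
variable {K V : Type*} [CommRing K] [LieRing V] [LieAlgebra K V]

instance : FunLike (LieAut K V) V V where
  coe g := g.toLieEquiv
  coe_injective := by
    rintro ⟨g⟩ ⟨h⟩ e
    congr
    exact DFunLike.coe_injective e

@[ext] lemma ext {g h : LieAut K V} (e : ∀ x, g x = h x) : g = h := DFunLike.ext _ _ e

instance : Group (LieAut K V) where
  mul g h := ⟨g.toLieEquiv.trans h.toLieEquiv⟩
  one := ⟨LieEquiv.refl⟩
  inv g := ⟨g.toLieEquiv.symm⟩
  mul_assoc _ _ _ := rfl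
  one_mul _ := rfl
  mul_one _ := rfl
  inv_mul_cancel g := ext fun x => g.toLieEquiv.apply_symm_apply x

lemma mul_apply (g h : LieAut K V) (x : V) : (g * h) x = h (g x) := rfl
lemma one_apply (x : V) : (1 : LieAut K V) x = x := rfl
lemma inv_apply_self (g : LieAut K V) (x : V) : g⁻¹ (g x) = x := g.toLieEquiv.symm_apply_apply x
lemma apply_inv_self (g : LieAut K V) (x : V) : g (g⁻¹ x) = x := g.toLieEquiv.apply_symm_apply x

end

section
variable (R K L : Type*) [CommRing R] [CommRing K] [Algebra R K] [LieRing L]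

/-- The image of `R ⊗ L` in `K ⊗ L`: the `R`-span of the elements `1 ⊗ x`. -/
def lattice : Submodule R (K ⊗[ℤ] L) :=
  Submodule.span R (Set.range fun x : L => (1 : K) ⊗ₜ[ℤ] x)

/-- `End_R(R ⊗ L) ∩ Aut_K(K ⊗ L)`: the automorphisms of `K ⊗ L` that map `R ⊗ L` into itself. -/
def Delta : Submonoid (LieAut K (K ⊗[ℤ] L)) where
  carrier := {g | ∀ x ∈ lattice R K L, g x ∈ lattice R K L}
  one_mem' := fun _ hx => hx
  mul_mem' := fun hg hh x hx => hh _ (hg x hx)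

/-- `Aut_R(R ⊗ L)`: the automorphisms of `K ⊗ L` that map `R ⊗ L` onto itself. -/
def Gamma : Subgroup (LieAut K (K ⊗[ℤ] L)) where
  carrier := {g | g ∈ Delta R K L ∧ g⁻¹ ∈ Delta R K L}
  one_mem' := ⟨one_mem _, by simp⟩
  mul_mem' := fun hg hh => ⟨mul_mem hg.1 hh.1, by simpa using mul_mem hh.2 hg.2⟩
  inv_mem' := fun hg => ⟨hg.2, by simpa using hg.1⟩

end

section
variable {K L : Type*} [CommRing K] [LieRing L]
variable (K' : Type*) [CommRing K'] [Algebra K K']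

lemma smul_lie_smul {K V : Type*} [CommRing K] [LieRing V] [LieAlgebra K V] (a b : K) (v w : V) :
    ⁅a • v, b • w⁆ = (a * b) • ⁅v, w⁆ := by
  rw [smul_lie, lie_smul, smul_smul]

/-- The natural map `K ⊗ L → K' ⊗ L`. -/
def scalarMap (K K' L : Type*) [CommRing K] [CommRing K'] [Algebra K K'] [LieRing L] :
    K ⊗[ℤ] L →ₗ⁅ℤ⁆ K' ⊗[ℤ] L :=
  LieAlgebra.ExtendScalars.map (Algebra.ofId K K' |>.restrictScalars ℤ) (LieHom.id)

/-- Extension of scalars of an automorphism of `K ⊗ L` to `K' ⊗ L`. -/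
def extendLinear (g : K ⊗[ℤ] L ≃ₗ[K] K ⊗[ℤ] L) : K' ⊗[ℤ] L ≃ₗ[K'] K' ⊗[ℤ] L :=
  (TensorProduct.AlgebraTensorModule.cancelBaseChange ℤ K K' K' L).symm ≪≫ₗ
    g.baseChange K K' _ _ ≪≫ₗ
      TensorProduct.AlgebraTensorModule.cancelBaseChange ℤ K K' K' L

lemma scalarMap_tmul (a : K) (x : L) :
    scalarMap K K' L (a ⊗ₜ[ℤ] x) = algebraMap K K' a ⊗ₜ[ℤ] x := rfl

lemma scalarMap_smul (a : K) (v : K ⊗[ℤ] L) :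
    scalarMap K K' L (a • v) = algebraMap K K' a • scalarMap K K' L v := by
  induction v with
  | zero => simp
  | tmul b x =>
    rw [TensorProduct.smul_tmul', scalarMap_tmul, scalarMap_tmul, TensorProduct.smul_tmul',
      smul_eq_mul, smul_eq_mul, map_mul]
  | add v w hv hw => simp only [smul_add, map_add, hv, hw]

lemma cancelBaseChange_tmul (a : K') (v : K ⊗[ℤ] L) :
    TensorProduct.AlgebraTensorModule.cancelBaseChange ℤ K K' K' L (a ⊗ₜ[K] v) =
      a • scalarMap K K' L v := by
  induction v with
  | zero => simp
  | tmul b x =>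
    simp [TensorProduct.smul_tmul', scalarMap_tmul, Algebra.smul_def, mul_comm]
  | add v w hv hw => simp only [TensorProduct.tmul_add, smul_add, map_add, hv, hw]

lemma extendLinear_tmul (g : K ⊗[ℤ] L ≃ₗ[K] K ⊗[ℤ] L) (a : K') (x : L) :
    extendLinear K' g (a ⊗ₜ x) = a • scalarMap K K' L (g (1 ⊗ₜ x)) := by
  simp [extendLinear, cancelBaseChange_tmul]

lemma extendLinear_scalarMap (g : K ⊗[ℤ] L ≃ₗ[K] K ⊗[ℤ] L) (v : K ⊗[ℤ] L) :
    extendLinear K' g (scalarMap K K' L v) = scalarMap K K' L (g v) := by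
  induction v with
  | zero => simp
  | tmul b x =>
    rw [scalarMap_tmul, extendLinear_tmul, ← scalarMap_smul, ← map_smul,
      TensorProduct.smul_tmul', smul_eq_mul, mul_one]
  | add v w hv hw => simp only [map_add, hv, hw]

lemma extendLinear_lie (g : K ⊗[ℤ] L ≃ₗ⁅K⁆ K ⊗[ℤ] L) (v w : K' ⊗[ℤ] L) :
    extendLinear K' g.toLinearEquiv ⁅v, w⁆ =
      ⁅extendLinear K' g.toLinearEquiv v, extendLinear K' g.toLinearEquiv w⁆ := by
  induction v with
  | zero => simp
  | add v v' hv hv' => simp only [add_lie, map_add, hv, hv']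
  | tmul a x =>
    induction w with
    | zero =>
      rw [map_zero]
      exact (congrArg _ (lie_zero (a ⊗ₜ[ℤ] x))).trans ((map_zero _).trans (lie_zero (extendLinear K' g.toLinearEquiv (a ⊗ₜ[ℤ] x))).symm)
    | add w w' hw hw' =>
      rw [map_add]
      refine (congrArg _ (lie_add (a ⊗ₜ[ℤ] x) w w')).trans ((map_add _ _ _).trans ?_)
      rw [hw, hw']
      exact (lie_add (extendLinear K' g.toLinearEquiv (a ⊗ₜ[ℤ] x)) _ _).symm
    | tmul b y =>
      have h : (1 : K) ⊗ₜ[ℤ] ⁅x, y⁆ = ⁅(1 : K) ⊗ₜ[ℤ] x, (1 : K) ⊗ₜ[ℤ] y⁆ := by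
        rw [LieAlgebra.ExtendScalars.bracket_tmul, mul_one]
      rw [LieAlgebra.ExtendScalars.bracket_tmul, extendLinear_tmul, extendLinear_tmul,
        extendLinear_tmul, h, LieEquiv.coe_toLinearEquiv, LieEquiv.map_lie, LieHom.map_lie]
      exact (smul_lie_smul a b _ _).symm

/-- Extension of scalars `Aut_K(K ⊗ L) → Aut_K'(K' ⊗ L)`. -/
def extendScalars : LieAut K (K ⊗[ℤ] L) →* LieAut K' (K' ⊗[ℤ] L) where
  toFun g := ⟨{ extendLinear K' g.toLieEquiv.toLinearEquiv with
    map_lie' := fun {v w} => extendLinear_lie K' g.toLieEquiv v w }⟩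
  map_one' := by
    ext v
    show extendLinear K' _ v = v
    induction v with
    | zero => simp
    | add v w hv hw => simp only [map_add, hv, hw]
    | tmul a x =>
      rw [extendLinear_tmul]
      show a • scalarMap K K' L (1 ⊗ₜ x) = _
      simp [scalarMap_tmul, TensorProduct.smul_tmul']
  map_mul' g h := by
    ext v
    show extendLinear K' _ v = extendLinear K' _ (extendLinear K' _ v)
    induction v with
    | zero => simp
    | add v w hv hw => simp only [map_add, hv, hw]
    | tmul a x =>
      rw [extendLinear_tmul, extendLinear_tmul, map_smul, extendLinear_scalarMap]
      rfl

end

section Commensurable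

lemma index_ne_zero_of_map {G T : Type*} [Group G] [Finite T] (S : Subgroup G) (F : G → T)
    (h : ∀ a b, F a = F b → a⁻¹ * b ∈ S) : S.index ≠ 0 := by
  have : Finite (G ⧸ S) := by
    refine Finite.of_injective (fun q : G ⧸ S => F q.out) fun q r e => ?_
    have := QuotientGroup.eq.2 (h _ _ e)
    rwa [QuotientGroup.out_eq', QuotientGroup.out_eq'] at this
  exact (Subgroup.finiteIndex_of_finite_quotient (H := S)).index_ne_zero

lemma mem_conj_iff {G : Type*} [Group G] (S : Subgroup G) (g u : G) :
    u ∈ ConjAct.toConjAct g • S ↔ g⁻¹ * u * g ∈ S := by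
  rw [Subgroup.mem_pointwise_smul_iff_inv_smul_mem, ← ConjAct.toConjAct_inv, ConjAct.smul_def]
  simp

lemma commensurable_of_relIndex {G : Type*} [Group G] (S : Subgroup G) (g : G)
    (h : ∀ x ∈ ({g, g⁻¹} : Set G), (ConjAct.toConjAct x • S).relIndex S ≠ 0) :
    g ∈ Subgroup.Commensurable.commensurator S := by
  rw [Subgroup.Commensurable.commensurator_mem_iff]
  refine ⟨h g (by simp), ?_⟩
  have := h g⁻¹ (by simp)
  rwa [← Subgroup.relIndex_pointwise_smul (ConjAct.toConjAct g), smul_smul,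
    ← ConjAct.toConjAct_mul, mul_inv_cancel, ConjAct.toConjAct_one, one_smul] at this

variable (R K L : Type*) [CommRing R] [Field K] [Algebra R K] [LieRing L]

lemma lattice_fg [Module.Finite ℤ L] : (lattice R K L).FG := by
  obtain ⟨s, hs⟩ := (Module.Finite.fg_top : (⊤ : Submodule ℤ L).FG)
  classical
  refine ⟨s.image fun x => (1 : K) ⊗ₜ[ℤ] x, le_antisymm (Submodule.span_mono ?_) ?_⟩
  · intro v hv
    simp only [Finset.coe_image, Set.mem_image] at hv
    obtain ⟨x, _, rfl⟩ := hv
    exact ⟨x, rfl⟩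
  · refine Submodule.span_le.2 ?_
    rintro _ ⟨x, rfl⟩
    have hx : x ∈ Submodule.span ℤ (s : Set L) := hs ▸ Submodule.mem_top
    induction hx using Submodule.span_induction with
    | mem y hy => exact Submodule.subset_span (by simpa using ⟨y, hy, rfl⟩)
    | zero => simp
    | add y z _ _ h1 h2 =>
      simp only [TensorProduct.tmul_add]
      exact add_mem h1 h2
    | smul n y _ h =>
      simp only [TensorProduct.tmul_smul]
      exact zsmul_mem h n

variable [IsFractionRing R K]

lemma exists_smul_mem (v : K ⊗[ℤ] L) :
    ∃ n : R, n ≠ 0 ∧ n • v ∈ lattice R K L := by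
  have : IsDomain R := (IsFractionRing.injective R K).isDomain (algebraMap R K)
  induction v with
  | zero => exact ⟨1, one_ne_zero, by simp⟩
  | tmul a x =>
    obtain ⟨r, s, hs, rfl⟩ := IsFractionRing.div_surjective (A := R) a
    have hs0 : s ≠ 0 := nonZeroDivisors.ne_zero hs
    have hs1 : algebraMap R K s ≠ 0 := by
      simpa using hs0
    refine ⟨s, hs0, ?_⟩
    have : s • ((algebraMap R K r / algebraMap R K s) ⊗ₜ[ℤ] x) = r • ((1 : K) ⊗ₜ[ℤ] x) := by
      rw [TensorProduct.smul_tmul', TensorProduct.smul_tmul', Algebra.smul_def, Algebra.smul_def,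
        mul_one, mul_div_cancel₀ _ hs1]
    rw [this]
    exact Submodule.smul_mem _ _ (Submodule.subset_span ⟨x, rfl⟩)
  | add v w hv hw =>
    obtain ⟨n, hn, h1⟩ := hv
    obtain ⟨m, hm, h2⟩ := hw
    refine ⟨n * m, mul_ne_zero hn hm, ?_⟩
    rw [smul_add]
    refine add_mem ?_ ?_
    · rw [mul_comm, mul_smul]
      exact Submodule.smul_mem _ _ h1
    · rw [mul_smul]
      exact Submodule.smul_mem _ _ h2

lemma apply_smul {R K V : Type*} [CommRing R] [CommRing K] [Algebra R K] [LieRing V]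
    [LieAlgebra K V] [Module R V] [IsScalarTower R K V] (g : LieAut K V) (n : R) (v : V) :
    g (n • v) = n • g v := by
  rw [← algebraMap_smul K n v, ← algebraMap_smul K n (g v)]
  exact map_smul g.toLieEquiv _ _

lemma exists_smul_apply_mem [Module.Finite ℤ L] (g : LieAut K (K ⊗[ℤ] L)) :
    ∃ n : R, n ≠ 0 ∧ ∀ x ∈ lattice R K L, n • g x ∈ lattice R K L := by
  have : IsDomain R := (IsFractionRing.injective R K).isDomain (algebraMap R K)
  classical
  obtain ⟨s, hs⟩ := lattice_fg R K L
  choose n hn hmem using exists_smul_mem R K L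
  refine ⟨∏ v ∈ s, n (g v), Finset.prod_ne_zero_iff.2 fun v _ => hn _, fun x hx => ?_⟩
  rw [← hs] at hx
  induction hx using Submodule.span_induction with
  | mem y hy =>
    rw [← Finset.prod_erase_mul s _ hy, mul_smul]
    exact Submodule.smul_mem _ _ (hmem _)
  | zero =>
    rw [show g 0 = 0 from map_zero g.toLieEquiv, smul_zero]
    exact zero_mem _
  | add y z _ _ h1 h2 =>
    rw [show g (y + z) = g y + g z from map_add g.toLieEquiv y z, smul_add]
    exact add_mem h1 h2
  | smul r y _ h =>
    rw [apply_smul, smul_comm]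
    exact Submodule.smul_mem _ _ h

variable [Ring.HasFiniteQuotients R]

lemma relIndex_conj_ne_zero [Module.Finite ℤ L] (g : LieAut K (K ⊗[ℤ] L)) :
    (ConjAct.toConjAct g • Gamma R K L).relIndex (Gamma R K L) ≠ 0 := by
  classical
  have : IsDomain R := (IsFractionRing.injective R K).isDomain (algebraMap R K)
  obtain ⟨n, hn, h1⟩ := exists_smul_apply_mem R K L g⁻¹
  obtain ⟨m, hm, h2⟩ := exists_smul_apply_mem R K L g
  obtain ⟨s, hs⟩ := lattice_fg R K L
  have hnm : Ideal.span {n * m} ≠ ⊥ := by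
    simpa using ⟨hn, hm⟩
  have hfin : Finite (R ⧸ Ideal.span {n * m}) := Ring.HasFiniteQuotients.finiteQuotient hnm
  have hcoef : ∀ (a : Gamma R K L) (v : s), ∃ c : K ⊗[ℤ] L → R,
      ∑ w ∈ s, c w • w = a.1 v.1 := fun a v => by
    have hv : a.1 v.1 ∈ lattice R K L := a.2.1 _ (hs ▸ Submodule.subset_span v.2)
    rw [← hs, Submodule.mem_span_finset] at hv
    obtain ⟨c, _, hc⟩ := hv
    exact ⟨c, hc⟩
  choose c hc using hcoef
  -- elements with congruent coefficients agree modulo `n * m`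
  have hcong : ∀ a b : Gamma R K L,
      (∀ v w : s, Ideal.Quotient.mk (Ideal.span {n * m}) (c a v w) =
        Ideal.Quotient.mk (Ideal.span {n * m}) (c b v w)) →
      ∀ x ∈ lattice R K L, ∃ y ∈ lattice R K L, b.1 x = a.1 x + (n * m) • y := by
    intro a b hab x hx
    rw [← hs] at hx
    induction hx using Submodule.span_induction with
    | mem v hv =>
      have : ∀ w : s, ∃ d : R, c b ⟨v, hv⟩ w = c a ⟨v, hv⟩ w + (n * m) * d := fun w => by
        have := Ideal.Quotient.eq.1 (hab ⟨v, hv⟩ w).symm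
        obtain ⟨d, hd⟩ := Ideal.mem_span_singleton.1 this
        exact ⟨d, by rw [← hd]; ring⟩
      choose d hd using this
      refine ⟨∑ w : s, d w • w.1, Submodule.sum_mem _ fun w _ => Submodule.smul_mem _ _
        (hs ▸ Submodule.subset_span w.2), ?_⟩
      rw [← hc a ⟨v, hv⟩, ← hc b ⟨v, hv⟩, ← Finset.sum_coe_sort s, ← Finset.sum_coe_sort s,
        Finset.smul_sum, ← Finset.sum_add_distrib]
      refine Finset.sum_congr rfl fun w _ => ?_
      rw [hd, add_smul, mul_smul (n * m)]
    | zero =>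
      refine ⟨0, zero_mem _, ?_⟩
      rw [show a.1 0 = 0 from map_zero a.1.toLieEquiv,
        show b.1 0 = 0 from map_zero b.1.toLieEquiv]
      simp
    | add v w _ _ hv hw =>
      obtain ⟨y, hy, e1⟩ := hv
      obtain ⟨z, hz, e2⟩ := hw
      refine ⟨y + z, add_mem hy hz, ?_⟩
      rw [show a.1 (v + w) = a.1 v + a.1 w from map_add a.1.toLieEquiv v w,
        show b.1 (v + w) = b.1 v + b.1 w from map_add b.1.toLieEquiv v w, e1, e2, smul_add]
      abel
    | smul r v _ hv =>
      obtain ⟨y, hy, e1⟩ := hv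
      refine ⟨r • y, Submodule.smul_mem _ _ hy, ?_⟩
      rw [apply_smul, apply_smul, e1, smul_add, smul_comm r]
  have hmain : ∀ a b : Gamma R K L,
      (∀ v w : s, Ideal.Quotient.mk (Ideal.span {n * m}) (c a v w) =
        Ideal.Quotient.mk (Ideal.span {n * m}) (c b v w)) →
      g⁻¹ * (a.1⁻¹ * b.1) * g ∈ Delta R K L := by
    intro a b hab x hx
    show g (b.1 (a.1⁻¹ (g⁻¹ x))) ∈ _
    obtain ⟨y, hy, e⟩ := hcong a b hab (a.1⁻¹ (n • g⁻¹ x)) (a.2.2 _ (h1 x hx))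
    rw [apply_inv_self, apply_smul (R := R) a.1⁻¹, apply_smul (R := R) b.1, mul_smul, ← smul_add] at e
    have hn' : algebraMap R K n ≠ 0 := by simpa using hn
    rw [← algebraMap_smul K n, ← algebraMap_smul K n (_ + _)] at e
    have e' := smul_right_injective _ hn' e
    rw [e', show g (g⁻¹ x + m • y) = g (g⁻¹ x) + g (m • y) from map_add g.toLieEquiv _ _,
      apply_inv_self, apply_smul (R := R) g]
    exact add_mem hx (h2 y hy)
  refine index_ne_zero_of_map _ (fun a : Gamma R K L => fun v w : s =>
    Ideal.Quotient.mk (Ideal.span {n * m}) (c a v w)) fun a b hab => ?_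
  have hab' := fun v w => congrFun (congrFun hab v) w
  rw [Subgroup.mem_subgroupOf, mem_conj_iff]
  refine ⟨hmain a b hab', ?_⟩
  have := hmain b a fun v w => (hab' v w).symm
  simpa [mul_assoc] using this

end Commensurable

end LieAut

namespace LieAut

/-- `(Γ, Δ)` is a Hecke pair. -/
instance isHeckeTriple (R K L : Type*) [CommRing R] [Field K] [Algebra R K] [LieRing L]
    [IsFractionRing R K] [Ring.HasFiniteQuotients R] [Module.Finite ℤ L] :
    IsHeckeTriple (Delta R K L) (Gamma R K L) (Gamma R K L) :=
  IsHeckeTriple.of_diagonal (fun _ hg => hg.1) fun g _ =>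
    commensurable_of_relIndex _ g fun x _ => relIndex_conj_ne_zero R K L x

instance (p : Nat.Primes) : Fact (p : ℕ).Prime := ⟨p.2⟩

instance padicInt_hasFiniteQuotients (p : ℕ) [Fact p.Prime] : Ring.HasFiniteQuotients ℤ_[p] where
  finiteQuotient := by
    intro I hI
    obtain ⟨n, rfl⟩ := PadicInt.ideal_eq_span_pow_p hI
    rw [← PadicInt.ker_toZModPow n]
    have : NeZero (p ^ n) := ⟨pow_ne_zero n (Fact.out : p.Prime).ne_zero⟩
    exact Finite.of_injective _ (RingHom.kerLift_injective (PadicInt.toZModPow (p := p) n))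

section Profinite

variable (L : Type*) [LieRing L]

/-- The product of the groups `G_{L_p} = Aut(L ⊗ ℚ_p)` over all primes `p`. The restricted product
is a subgroup; it contains `GammaHat` and `DeltaHat`, and the Hecke ring only depends on these. -/
abbrev ProdGroup : Type _ := ∀ p : Nat.Primes, LieAut ℚ_[p] (ℚ_[p] ⊗[ℤ] L)

/-- `∏_p Γ_{L_p}`. -/
def GammaHat : Subgroup (ProdGroup L) where
  carrier := {g | ∀ p : Nat.Primes, g p ∈ Gamma ℤ_[p] ℚ_[p] L}
  one_mem' := fun _ => one_mem _
  mul_mem' := fun hg hh p => mul_mem (hg p) (hh p)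
  inv_mem' := fun hg p => inv_mem (hg p)

/-- The families in `∏_p Δ_{L_p}` whose components lie in `Γ_{L_p}` for almost all `p`. -/
def DeltaHat : Submonoid (ProdGroup L) where
  carrier := {g | (∀ p : Nat.Primes, g p ∈ Delta ℤ_[p] ℚ_[p] L) ∧ {p : Nat.Primes | g p ∉ Gamma ℤ_[p] ℚ_[p] L}.Finite}
  one_mem' := ⟨fun p => one_mem _, by simp [one_mem]⟩
  mul_mem' := fun {g h} hg hh => ⟨fun p => mul_mem (hg.1 p) (hh.1 p),
    (hg.2.union hh.2).subset fun p hp => by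
      by_contra hp'
      simp only [Set.mem_union, Set.mem_ofPred_eq, not_or, not_not] at hp'
      exact hp (mul_mem hp'.1 hp'.2)⟩

lemma relIndex_conj_hat_ne_zero [Module.Finite ℤ L] (g : ProdGroup L)
    (hg : {p : Nat.Primes | g p ∉ Gamma ℤ_[p] ℚ_[p] L}.Finite) :
    (ConjAct.toConjAct g • GammaHat L).relIndex (GammaHat L) ≠ 0 := by
  have hfin : Finite {p : Nat.Primes | g p ∉ Gamma ℤ_[p] ℚ_[p] L} := hg
  let S (p : Nat.Primes) : Subgroup (Gamma ℤ_[p] ℚ_[p] L) :=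
    (ConjAct.toConjAct (g p) • Gamma ℤ_[p] ℚ_[p] L).subgroupOf (Gamma ℤ_[p] ℚ_[p] L)
  have hS : ∀ p : Nat.Primes, Finite (Gamma ℤ_[p] ℚ_[p] L ⧸ S p) := fun p => by
    have : (S p).FiniteIndex := ⟨relIndex_conj_ne_zero ℤ_[p] ℚ_[p] L (g p)⟩
    exact Subgroup.finite_quotient_of_finiteIndex
  refine index_ne_zero_of_map _ (fun (a : GammaHat L) (p : {p : Nat.Primes | g p ∉ Gamma ℤ_[p] ℚ_[p] L}) =>
    (QuotientGroup.mk (⟨a.1 p.1, a.2 p.1⟩ : Gamma ℤ_[p.1] ℚ_[p.1] L) :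
      Gamma ℤ_[p.1] ℚ_[p.1] L ⧸ S p.1)) fun a b hab => ?_
  rw [Subgroup.mem_subgroupOf, mem_conj_iff]
  intro p
  by_cases hp : g p ∈ Gamma ℤ_[p] ℚ_[p] L
  · exact mul_mem (mul_mem (inv_mem hp) (mul_mem (inv_mem (a.2 p)) (b.2 p))) hp
  · have h1 := QuotientGroup.eq.1 (congrFun hab ⟨p, hp⟩)
    rwa [Subgroup.mem_subgroupOf, mem_conj_iff] at h1

/-- `(Γ̂, Δ̂)` is a Hecke pair. -/
instance isHeckeTriple_hat [Module.Finite ℤ L] :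
    IsHeckeTriple (DeltaHat L) (GammaHat L) (GammaHat L) :=
  IsHeckeTriple.of_diagonal (fun g hg => ⟨fun p => (hg p).1, by simp [hg _]⟩) fun g hg =>
    commensurable_of_relIndex _ g fun x hx => relIndex_conj_hat_ne_zero L x (by
      rcases hx with rfl | rfl
      · exact hg.2
      · simpa using hg.2)

/-- The global Hecke ring `R_L`, with respect to
`(Aut_ℤ(L), End_ℤ(L) ∩ Aut_ℚ(L ⊗ ℚ))`. -/
abbrev GlobalHeckeRing : Type _ := HeckeRing (Delta ℤ ℚ L) (Gamma ℤ ℚ L) ℤ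

/-- The local Hecke ring `R_{L_p}`, with respect to
`(Aut_{ℤ_p}(L ⊗ ℤ_p), End_{ℤ_p}(L ⊗ ℤ_p) ∩ Aut_{ℚ_p}(L ⊗ ℚ_p))`. -/
abbrev LocalHeckeRing (p : Nat.Primes) : Type _ :=
  HeckeRing (Delta ℤ_[p] ℚ_[p] L) (Gamma ℤ_[p] ℚ_[p] L) ℤ

/-- The Hecke ring `R̂_L` of the profinite completion, with respect to `(Γ̂, Δ̂)`. -/
abbrev ProfiniteHeckeRing : Type _ := HeckeRing (DeltaHat L) (GammaHat L) ℤ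

/-- The natural inclusion of `Δ_{L_p}` into `Δ̂`, with component `1` at the primes `≠ p`. -/
def localIncl (p : Nat.Primes) (g : Delta ℤ_[p] ℚ_[p] L) : DeltaHat L :=
  ⟨Pi.mulSingle p g.1, fun q => by
      rcases eq_or_ne q p with rfl | h
      · simp
      · simp [h, one_mem],
    (Set.finite_singleton p).subset fun q hq => by
      by_contra h
      exact hq (by simp [Pi.mulSingle_eq_of_ne (show q ≠ p from h), one_mem])⟩

/-- The map of double cosets `Γ_p α Γ_p ↦ Γ̂ α Γ̂`. -/
def localCoset (p : Nat.Primes) :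
    HeckeCoset (Delta ℤ_[p] ℚ_[p] L) (Gamma ℤ_[p] ℚ_[p] L) (Gamma ℤ_[p] ℚ_[p] L) →
      HeckeCoset (DeltaHat L) (GammaHat L) (GammaHat L) :=
  Quotient.lift (fun g => HeckeCoset.mk _ _ (localIncl L p g)) (by
    intro g h e
    obtain ⟨a, ha, b, hb, e⟩ := DoubleCoset.rel_iff.1 e
    have hmem : ∀ c ∈ Gamma ℤ_[p] ℚ_[p] L, (Pi.mulSingle p c : ProdGroup L) ∈ GammaHat L := by
      intro c hc
      show ∀ q : Nat.Primes, _
      intro q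
      rcases eq_or_ne q p with rfl | h
      · simpa using hc
      · simp [h, one_mem]
    refine HeckePair.mk_eq_mk.2 ⟨_, hmem a ha, _, hmem b hb, ?_⟩
    show (Pi.mulSingle p h.1 : ProdGroup L) =
      Pi.mulSingle p a * Pi.mulSingle p g.1 * Pi.mulSingle p b
    rw [e, Pi.mulSingle_mul, Pi.mulSingle_mul])

/-- The additive map `R_{L_p} → R̂_L` derived from the inclusion `Δ_{L_p} ⊆ Δ̂`. -/
def localMap (p : Nat.Primes) : LocalHeckeRing L p →+ ProfiniteHeckeRing L :=
  (Finsupp.mapDomain.addMonoidHom (localCoset L p) : (_ →₀ ℤ) →+ (_ →₀ ℤ))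

/-- The diagonal embedding `g ↦ (g)_p`, by extension of scalars from `ℚ` to `ℚ_p`. -/
def eta : LieAut ℚ (ℚ ⊗[ℤ] L) →* ProdGroup L :=
  MonoidHom.pi fun p => extendScalars ℚ_[p]

/-- The set `Γ_L \ η⁻¹(D) / Γ_L` of double cosets, for a double coset `D = Γ̂ α Γ̂`. -/
def etaFiber (D : HeckeCoset (DeltaHat L) (GammaHat L) (GammaHat L)) :
    Set (HeckeCoset (Delta ℤ ℚ L) (Gamma ℤ ℚ L) (Gamma ℤ ℚ L)) :=
  HeckeCoset.mk (Gamma ℤ ℚ L) (Gamma ℤ ℚ L) ''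
    {β | ∃ α : DeltaHat L, (α : ProdGroup L) = eta L β ∧ HeckeCoset.mk _ _ α = D}

/-- The additive map `η_L^* : R̂_L → R_L` sending a double coset `D = Γ̂ α Γ̂` to the sum of the
double cosets in `Γ_L \ η⁻¹(D) / Γ_L`. (This set is finite, as `Γ_L \ η⁻¹(D)` injects into
`Γ̂ \ D`.) -/
def etaStar : ProfiniteHeckeRing L →+ GlobalHeckeRing L :=
  (Finsupp.liftAddHom fun D => zmultiplesHom (GlobalHeckeRing L)
    (∑ᶠ E ∈ etaFiber L D, HeckeCosetModule.of (Finsupp.single E 1)) :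
      (HeckeCoset (DeltaHat L) (GammaHat L) (GammaHat L) →₀ ℤ) →+ GlobalHeckeRing L)

end Profinite

end LieAut

/-- The ideal `[L₂, [L₂, L₂]]` of the free Lie algebra `L₂` on two generators. -/
def heisenbergIdeal : LieIdeal ℤ (FreeLieAlgebra ℤ (Fin 2)) :=
  ⁅(⊤ : LieIdeal ℤ (FreeLieAlgebra ℤ (Fin 2))),
    ⁅(⊤ : LieIdeal ℤ (FreeLieAlgebra ℤ (Fin 2))), (⊤ : LieIdeal ℤ (FreeLieAlgebra ℤ (Fin 2)))⁆⁆

/-- The Heisenberg Lie algebra `L₂ / [L₂, [L₂, L₂]]` over `ℤ`. -/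
def Heisenberg : Type := FreeLieAlgebra ℤ (Fin 2) ⧸ heisenbergIdeal

namespace Heisenberg

instance : LieRing Heisenberg :=
  inferInstanceAs (LieRing (FreeLieAlgebra ℤ (Fin 2) ⧸ heisenbergIdeal))

/-- The projection from the free Lie algebra. -/
def proj : FreeLieAlgebra ℤ (Fin 2) →ₗ⁅ℤ⁆ Heisenberg :=
  { (LieSubmodule.Quotient.mk' heisenbergIdeal).toLinearMap.toAddMonoidHom.toIntLinearMap with
    map_lie' := by intro x y; rfl }

lemma proj_surjective : Function.Surjective proj := by
  rintro ⟨x⟩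
  exact ⟨x, rfl⟩

lemma lie_lie_eq_zero (a b c : Heisenberg) : ⁅a, ⁅b, c⁆⁆ = 0 := by
  obtain ⟨a, rfl⟩ := proj_surjective a
  obtain ⟨b, rfl⟩ := proj_surjective b
  obtain ⟨c, rfl⟩ := proj_surjective c
  rw [← LieHom.map_lie, ← LieHom.map_lie]
  refine (LieSubmodule.Quotient.mk_eq_zero' (N := heisenbergIdeal)).2 ?_
  exact LieSubmodule.lie_mem_lie (LieSubmodule.mem_top _)
    (LieSubmodule.lie_mem_lie (LieSubmodule.mem_top _) (LieSubmodule.mem_top _))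

/-- The two generators. -/
def gen (i : Fin 2) : Heisenberg := proj (FreeLieAlgebra.of ℤ i)

/-- The subalgebra spanned by the generators and their bracket. -/
def spanSubalgebra : LieSubalgebra ℤ Heisenberg :=
  { Submodule.span ℤ {gen 0, gen 1, ⁅gen 0, gen 1⁆} with
    lie_mem' := by
      intro u v hu hv
      have hu' : u ∈ Submodule.span ℤ {gen 0, gen 1, ⁅gen 0, gen 1⁆} := hu
      have hv' : v ∈ Submodule.span ℤ {gen 0, gen 1, ⁅gen 0, gen 1⁆} := hv
      rw [Submodule.mem_span_triple] at hu' hv'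
      obtain ⟨a, b, c, rfl⟩ := hu'
      obtain ⟨a', b', c', rfl⟩ := hv'
      refine Submodule.mem_span_triple.2 ⟨0, 0, a * b' - b * a', ?_⟩
      have h : ∀ x y z : Heisenberg, ⁅⁅y, z⁆, x⁆ = 0 := fun x y z => by
        rw [← lie_skew, lie_lie_eq_zero, neg_zero]
      simp only [add_lie, lie_add, smul_lie, lie_smul, lie_lie_eq_zero, h, lie_self,
        ← lie_skew (gen 1) (gen 0), smul_zero]
      module }

instance : Module.Finite ℤ Heisenberg := by
  classical
  refine ⟨⟨{gen 0, gen 1, ⁅gen 0, gen 1⁆}, eq_top_iff.2 fun u _ => ?_⟩⟩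
  obtain ⟨x, rfl⟩ := proj_surjective u
  have hgen : ∀ i, gen i ∈ spanSubalgebra := by
    intro i
    show gen i ∈ Submodule.span ℤ {gen 0, gen 1, ⁅gen 0, gen 1⁆}
    fin_cases i
    · exact Submodule.subset_span (by simp)
    · exact Submodule.subset_span (by simp)
  let F : FreeLieAlgebra ℤ (Fin 2) →ₗ⁅ℤ⁆ spanSubalgebra :=
    FreeLieAlgebra.lift ℤ fun i => ⟨gen i, hgen i⟩
  have hF : spanSubalgebra.incl.comp F = proj := by
    refine FreeLieAlgebra.hom_ext fun i => ?_
    show (F (FreeLieAlgebra.of ℤ i) : Heisenberg) = gen i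
    exact congrArg Subtype.val (FreeLieAlgebra.lift_of_apply
      (fun i => (⟨gen i, hgen i⟩ : spanSubalgebra)) i)
  have hx : proj x ∈ spanSubalgebra := by
    rw [← hF]
    exact (F x).2
  have hx' : proj x ∈ Submodule.span ℤ {gen 0, gen 1, ⁅gen 0, gen 1⁆} := hx
  simpa using hx'

end Heisenberg

end

/-!
Elements of a Hecke ring are bi-invariant functions under convolution. Membership in `Γ` and `Δ` can
be tested at every prime, and by strong approximation `Γ_p \ G_p` is in bijection with `Γ \ U_p`,
where `U_p` consists of the global automorphisms that lie in `Γ_q` for all `q ≠ p`. Hence pulling a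
function on `G_p` back to `U_p`, extended by zero, respects convolution, and this pullback is
`η^* ∘ ι_p`. Pullbacks `f` from `p` and `g` from `q ≠ p` convolve to `x ↦ f (x_p) * g (x_q)` on
their common support, which is symmetric in the two primes.

Restricted to `U_p`, every element of the subring generated by the local images factors through
`G_p`. Over `ℚ` there are double cosets in `U_5` that agree at `5` but differ globally: conjugation
by units of `ℤ_5` identifies them, but `Γ` provides only determinants `±1`.
-/

noncomputable section

namespace HeckePair

section HeckeRing

variable {G : Type*} [Group G] {Δ : Submonoid G} {H : Subgroup G}

/-- The additive homomorphism underlying `toFun`, which views an element of the Hecke ring as a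
bi-invariant function. -/
def toFunHom : HeckeRing Δ H ℤ →+ (G → ℤ) where
  toFun := toFun
  map_zero' := toFun_zero
  map_add' := toFun_add

lemma toFun_neg (f : HeckeRing Δ H ℤ) : toFun (-f) = -toFun f :=
  map_neg (toFunHom (Δ := Δ) (H := H)) f

lemma toFun_zsmul (n : ℤ) (f : HeckeRing Δ H ℤ) : toFun (n • f) = n • toFun f :=
  map_zsmul (toFunHom (Δ := Δ) (H := H)) n f

lemma toFun_finsum_mem {ι : Type*} {s : Set ι} (hs : s.Finite) (f : ι → HeckeRing Δ H ℤ) (x : G) :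
    toFun (∑ᶠ i ∈ s, f i) x = ∑ᶠ i ∈ s, toFun (f i) x :=
  ((Pi.evalAddMonoidHom (fun _ : G => ℤ) x).comp toFunHom).map_finsum_mem f hs

open Classical in
lemma toFun_finsum_mem_single {S : Set (HeckeCoset Δ H H)} (hS : S.Finite) (x : Δ) :
    toFun (∑ᶠ E ∈ S, (HeckeCosetModule.of (Finsupp.single E 1) : HeckeRing Δ H ℤ)) x =
      if HeckeCoset.mk H H x ∈ S then 1 else 0 := by
  have apply_single (E : HeckeCoset Δ H H) :
      toFun (HeckeCosetModule.of (Finsupp.single E 1) : HeckeRing Δ H ℤ) x =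
        if E = HeckeCoset.mk H H x then 1 else 0 := by
    rw [toFun_coe, HeckeCosetModule.of_apply, Finsupp.single_apply]
  simp only [toFun_finsum_mem hS, apply_single]
  rw [finsum_mem_eq_finite_toFinset_sum _ hS, Finset.sum_ite_eq']
  simp only [Set.Finite.mem_toFinset]

lemma addHom_ext {A : Type*} [AddCommGroup A] {f g : HeckeRing Δ H ℤ →+ A}
    (h : ∀ α : Δ, f (basis H α) = g (basis H α)) : f = g := by
  refine Finsupp.addHom_ext' (M := ℤ) fun D => AddMonoidHom.ext_int ?_
  obtain ⟨α, rfl⟩ := Quotient.exists_rep D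
  exact h α

lemma support_conv_subset {φ ψ : G → ℤ} {U : Subgroup G} (hφ : φ.support ⊆ U)
    (hψ : ψ.support ⊆ U) : (conv H φ ψ).support ⊆ U := by
  intro ξ hξ
  obtain ⟨c, hφc, hψc⟩ := IsHeckeFun.exists_of_conv_ne_zero hξ
  simpa using mul_mem (hφ hφc) (hψ hψc)

lemma IsHeckeFun.conv_eq_mul {φ ψ : G → ℤ} (hφ : IsHeckeFun Δ H φ) (hψ : IsHeckeFun Δ H ψ)
    {ξ γ : G} (h : ∀ x, φ (ξ * x⁻¹) ≠ 0 → ψ x ≠ 0 → γ * x⁻¹ ∈ H) :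
    conv H φ ψ ξ = φ (ξ * γ⁻¹) * ψ γ := by
  unfold conv
  rw [finsum_eq_single _ (Quotient.mk (QuotientGroup.rightRel H) γ)]
  · obtain ⟨a, ha, hout⟩ := out_mk H γ
    rw [hout, hφ.summand_eq hψ ha]
  · intro c hc
    by_contra hne
    refine hc ?_
    rw [← Quotient.out_eq c]
    exact Quotient.sound (QuotientGroup.rightRel_apply.2
      (h _ (left_ne_zero_of_mul hne) (right_ne_zero_of_mul hne)))

end HeckeRing

variable {G ι : Type*} [Group G] {Gl : ι → Type*} [∀ p, Group (Gl p)]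

/-- The elements of `G` that lie in `Γl q` at every place `q` outside `S`. -/
def unramifiedOutside (Γl : ∀ p, Subgroup (Gl p)) (η : ∀ p, G →* Gl p) (S : Set ι) : Subgroup G :=
  ⨅ q ∈ Sᶜ, (Γl q).comap (η q)

lemma mem_unramifiedOutside {Γl : ∀ p, Subgroup (Gl p)} {η : ∀ p, G →* Gl p} {S : Set ι} {g : G} :
    g ∈ unramifiedOutside Γl η S ↔ ∀ q ∉ S, η q g ∈ Γl q := by
  simp [unramifiedOutside, Subgroup.mem_iInf]

/-- The local-global principle for a group `G` with localizations `η p : G →* Gl p`: membership in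
`Δ` and `Γ` is a local condition, `Γl p` is the group of units of `Δl p`, and strong approximation
holds in the form that every coset `Γl p * g` has a global representative that is unramified
outside `p`. -/
structure IsLocalGlobal (Δ : Submonoid G) (Γ : Subgroup G) (Δl : ∀ p, Submonoid (Gl p))
    (Γl : ∀ p, Subgroup (Gl p)) (η : ∀ p, G →* Gl p) : Prop where
  mem_gamma_iff : ∀ g, g ∈ Γ ↔ ∀ p, η p g ∈ Γl p
  mem_delta_iff : ∀ g, g ∈ Δ ↔ ∀ p, η p g ∈ Δl p
  mem_local_iff : ∀ p g, g ∈ Γl p ↔ g ∈ Δl p ∧ g⁻¹ ∈ Δl p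
  exists_global : ∀ p g, ∃ γ ∈ unramifiedOutside Γl η {p}, η p γ * g⁻¹ ∈ Γl p

/-- The function `f` on the local group at `p`, transported to the global elements unramified
outside `p` and extended by zero. -/
def pullback (Γl : ∀ p, Subgroup (Gl p)) (η : ∀ p, G →* Gl p) (p : ι) (f : Gl p → ℤ) : G → ℤ :=
  (unramifiedOutside Γl η {p} : Set G).indicator (f ∘ η p)

section Pullback

variable {Γl : ∀ p, Subgroup (Gl p)} {η : ∀ p, G →* Gl p} {p : ι}

lemma pullback_of_mem (f : Gl p → ℤ) {g : G} (hg : g ∈ unramifiedOutside Γl η {p}) :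
    pullback Γl η p f g = f (η p g) :=
  Set.indicator_of_mem hg _

lemma pullback_of_notMem (f : Gl p → ℤ) {g : G} (hg : g ∉ unramifiedOutside Γl η {p}) :
    pullback Γl η p f g = 0 :=
  Set.indicator_of_notMem hg _

lemma support_pullback_subset (f : Gl p → ℤ) :
    (pullback Γl η p f).support ⊆ unramifiedOutside Γl η {p} :=
  Set.support_indicator_subset

lemma eq_pullback {φ : G → ℤ} {f : Gl p → ℤ} (hφ : φ.support ⊆ unramifiedOutside Γl η {p})
    (h : Set.EqOn φ (f ∘ η p) (unramifiedOutside Γl η {p})) : φ = pullback Γl η p f :=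
  (Set.indicator_eq_self.2 hφ).symm.trans (Set.indicator_congr h)

end Pullback

namespace IsLocalGlobal

variable {Δ : Submonoid G} {Γ : Subgroup G} {Δl : ∀ p, Submonoid (Gl p)}
  {Γl : ∀ p, Subgroup (Gl p)} {η : ∀ p, G →* Gl p}

lemma gamma_le_unramifiedOutside (h : IsLocalGlobal Δ Γ Δl Γl η) (S : Set ι) :
    Γ ≤ unramifiedOutside Γl η S :=
  fun _ hg => mem_unramifiedOutside.2 fun q _ => (h.mem_gamma_iff _).1 hg q

lemma mem_gamma_iff_of_mem_unramifiedOutside (h : IsLocalGlobal Δ Γ Δl Γl η) {p : ι} {g : G}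
    (hg : g ∈ unramifiedOutside Γl η {p}) : g ∈ Γ ↔ η p g ∈ Γl p := by
  refine ⟨fun hΓ => (h.mem_gamma_iff g).1 hΓ p, fun hp => (h.mem_gamma_iff g).2 fun q => ?_⟩
  rcases eq_or_ne q p with rfl | hq
  · exact hp
  · exact mem_unramifiedOutside.1 hg q hq

lemma mem_delta_of_mem_unramifiedOutside (h : IsLocalGlobal Δ Γ Δl Γl η) {p : ι} {g : G}
    (hg : g ∈ unramifiedOutside Γl η {p}) (hp : η p g ∈ Δl p) : g ∈ Δ := by
  refine (h.mem_delta_iff g).2 fun q => ?_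
  rcases eq_or_ne q p with rfl | hq
  · exact hp
  · exact ((h.mem_local_iff q _).1 (mem_unramifiedOutside.1 hg q hq)).1

lemma right_mem_unramifiedOutside (h : IsLocalGlobal Δ Γ Δl Γl η) {S : Set ι} {a b : G}
    (ha : a ∈ Δ) (hb : b ∈ Δ) (hab : a * b ∈ unramifiedOutside Γl η S) :
    b ∈ unramifiedOutside Γl η S := by
  refine mem_unramifiedOutside.2 fun q hq => ?_
  have hinv := ((h.mem_local_iff q _).1 (mem_unramifiedOutside.1 hab q hq)).2
  refine (h.mem_local_iff q _).2 ⟨(h.mem_delta_iff b).1 hb q, ?_⟩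
  simpa using mul_mem hinv ((h.mem_delta_iff a).1 ha q)

/-- The map `Γ g ↦ Γl p (η p g)` on cosets. -/
def cosetMap (h : IsLocalGlobal Δ Γ Δl Γl η) (p : ι) : Cosets Γ → Cosets (Γl p) :=
  Quotient.map (η p) fun x y hxy => by
    have hxy' := (h.mem_gamma_iff _).1 (QuotientGroup.rightRel_apply.1 hxy) p
    exact QuotientGroup.rightRel_apply.2 (by simpa using hxy')

lemma cosetMap_eq (h : IsLocalGlobal Δ Γ Δl Γl η) (p : ι) (c : Cosets Γ) :
    h.cosetMap p c = Quotient.mk (QuotientGroup.rightRel (Γl p)) (η p c.out) := by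
  conv_lhs => rw [← Quotient.out_eq c]
  rfl

lemma out_cosetMap (h : IsLocalGlobal Δ Γ Δl Γl η) (p : ι) (c : Cosets Γ) :
    ∃ a ∈ Γl p, (h.cosetMap p c).out = a * η p c.out := by
  rw [cosetMap_eq]
  exact out_mk _ _

lemma out_mk_mem_unramifiedOutside (h : IsLocalGlobal Δ Γ Δl Γl η) {S : Set ι} {g : G}
    (hg : g ∈ unramifiedOutside Γl η S) :
    (Quotient.mk (QuotientGroup.rightRel Γ) g).out ∈ unramifiedOutside Γl η S := by
  obtain ⟨a, ha, hout⟩ := out_mk Γ g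
  rw [hout]
  exact mul_mem (h.gamma_le_unramifiedOutside S ha) hg

lemma injOn_cosetMap (h : IsLocalGlobal Δ Γ Δl Γl η) (p : ι) :
    Set.InjOn (h.cosetMap p) {c | c.out ∈ unramifiedOutside Γl η {p}} := by
  intro c hc d hd hcd
  rw [cosetMap_eq, cosetMap_eq] at hcd
  have hlocal := QuotientGroup.rightRel_apply.1 (Quotient.exact hcd)
  rw [← Quotient.out_eq c, ← Quotient.out_eq d]
  refine Quotient.sound (QuotientGroup.rightRel_apply.2 ?_)
  exact (h.mem_gamma_iff_of_mem_unramifiedOutside (mul_mem hd (inv_mem hc))).2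
    (by simpa using hlocal)

lemma bijOn_cosetMap (h : IsLocalGlobal Δ Γ Δl Γl η) (p : ι) :
    Set.BijOn (h.cosetMap p) {c | c.out ∈ unramifiedOutside Γl η {p}} Set.univ := by
  refine ⟨fun _ _ => Set.mem_univ _, h.injOn_cosetMap p, fun d _ => ?_⟩
  obtain ⟨γ, hγ, hγd⟩ := h.exists_global p d.out
  refine ⟨Quotient.mk _ γ, h.out_mk_mem_unramifiedOutside hγ, ?_⟩
  conv_rhs => rw [← Quotient.out_eq d]
  exact Quotient.sound (QuotientGroup.rightRel_apply.2 (by simpa using inv_mem hγd))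

lemma eqOn_conv (h : IsLocalGlobal Δ Γ Δl Γl η) {p : ι} {φ ψ : G → ℤ} {f g : Gl p → ℤ}
    (hφ : φ.support ⊆ Δ) (hψ : ψ.support ⊆ Δ)
    (hf : IsHeckeFun (Δl p) (Γl p) f) (hg : IsHeckeFun (Δl p) (Γl p) g)
    (hφf : Set.EqOn φ (f ∘ η p) (unramifiedOutside Γl η {p}))
    (hψg : Set.EqOn ψ (g ∘ η p) (unramifiedOutside Γl η {p})) :
    Set.EqOn (conv Γ φ ψ) (conv (Γl p) f g ∘ η p) (unramifiedOutside Γl η {p}) := by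
  intro ξ hξ
  have summand_eq (c : Cosets Γ) (hc : c.out ∈ unramifiedOutside Γl η {p}) :
      φ (ξ * c.out⁻¹) * ψ c.out =
        f (η p ξ * (h.cosetMap p c).out⁻¹) * g (h.cosetMap p c).out := by
    obtain ⟨a, ha, hout⟩ := h.out_cosetMap p c
    rw [hout, hf.summand_eq hg ha, hφf (mul_mem hξ (inv_mem hc)), hψg hc, Function.comp_apply,
      Function.comp_apply, map_mul, map_inv]
  have support_subset : (fun c : Cosets Γ => φ (ξ * c.out⁻¹) * ψ c.out).support ⊆
      {c | c.out ∈ unramifiedOutside Γl η {p}} := fun c hc =>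
    h.right_mem_unramifiedOutside (hφ (left_ne_zero_of_mul hc)) (hψ (right_ne_zero_of_mul hc))
      (by simpa using hξ)
  calc conv Γ φ ψ ξ
      = ∑ᶠ c ∈ {c : Cosets Γ | c.out ∈ unramifiedOutside Γl η {p}},
          φ (ξ * c.out⁻¹) * ψ c.out := by
        rw [finsum_mem_def, Set.indicator_eq_self.2 support_subset, conv]
    _ = ∑ᶠ d ∈ (Set.univ : Set (Cosets (Γl p))), f (η p ξ * d.out⁻¹) * g d.out :=
        finsum_mem_eq_of_bijOn _ (h.bijOn_cosetMap p) summand_eq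
    _ = conv (Γl p) f g (η p ξ) := finsum_mem_univ _

lemma isHeckeFun_pullback (h : IsLocalGlobal Δ Γ Δl Γl η) {p : ι} {f : Gl p → ℤ}
    (hf : IsHeckeFun (Δl p) (Γl p) f) : IsHeckeFun Δ Γ (pullback Γl η p f) where
  left_inv a ha x := by
    have ha' := h.gamma_le_unramifiedOutside {p} ha
    by_cases hx : x ∈ unramifiedOutside Γl η {p}
    · rw [pullback_of_mem f hx, pullback_of_mem f (mul_mem ha' hx), map_mul,
        hf.left_inv _ ((h.mem_gamma_iff a).1 ha p)]
    · rw [pullback_of_notMem f hx,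
        pullback_of_notMem f (by rwa [Subgroup.mul_mem_cancel_left _ ha'])]
  right_inv a ha x := by
    have ha' := h.gamma_le_unramifiedOutside {p} ha
    by_cases hx : x ∈ unramifiedOutside Γl η {p}
    · rw [pullback_of_mem f hx, pullback_of_mem f (mul_mem hx ha'), map_mul,
        hf.right_inv _ ((h.mem_gamma_iff a).1 ha p)]
    · rw [pullback_of_notMem f hx,
        pullback_of_notMem f (by rwa [Subgroup.mul_mem_cancel_right _ ha'])]
  finite := by
    have hsub : {c : Cosets Γ | pullback Γl η p f c.out ≠ 0} ⊆
        {c | c.out ∈ unramifiedOutside Γl η {p}} := fun _ hc => support_pullback_subset f hc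
    refine Set.Finite.of_finite_image (hf.finite.subset ?_) ((h.injOn_cosetMap p).mono hsub)
    rintro _ ⟨c, hc, rfl⟩
    obtain ⟨a, ha, hout⟩ := h.out_cosetMap p c
    rw [Set.mem_ofPred_eq, hout, hf.left_inv a ha, ← pullback_of_mem f (hsub hc)]
    exact hc
  supp x hx := by
    have hx' := support_pullback_subset f hx
    rw [pullback_of_mem f hx'] at hx
    exact h.mem_delta_of_mem_unramifiedOutside hx' (hf.supp _ hx)

lemma conv_pullback (h : IsLocalGlobal Δ Γ Δl Γl η) {p : ι} {f g : Gl p → ℤ}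
    (hf : IsHeckeFun (Δl p) (Γl p) f) (hg : IsHeckeFun (Δl p) (Γl p) g) :
    conv Γ (pullback Γl η p f) (pullback Γl η p g) = pullback Γl η p (conv (Γl p) f g) :=
  eq_pullback (support_conv_subset (support_pullback_subset f) (support_pullback_subset g))
    (h.eqOn_conv (h.isHeckeFun_pullback hf).supp (h.isHeckeFun_pullback hg).supp hf hg
      (fun _ hx => pullback_of_mem f hx) (fun _ hx => pullback_of_mem g hx))

lemma conv_pullback_of_ne (h : IsLocalGlobal Δ Γ Δl Γl η) {p q : ι} (hpq : p ≠ q) {f : Gl p → ℤ}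
    {g : Gl q → ℤ} (hf : IsHeckeFun (Δl p) (Γl p) f) (hg : IsHeckeFun (Δl q) (Γl q) g) {ξ : G}
    (hξ : ξ ∈ unramifiedOutside Γl η {p, q}) :
    conv Γ (pullback Γl η p f) (pullback Γl η q g) ξ = f (η p ξ) * g (η q ξ) := by
  obtain ⟨γ, hγ, hγq⟩ := h.exists_global q (η q ξ)
  have hξγ : ξ * γ⁻¹ ∈ unramifiedOutside Γl η {p} := by
    refine mem_unramifiedOutside.2 fun r hr => ?_
    rw [map_mul, map_inv]
    rcases eq_or_ne r q with rfl | hrq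
    · simpa using inv_mem hγq
    · exact mul_mem (mem_unramifiedOutside.1 hξ r (by simp_all))
        (inv_mem (mem_unramifiedOutside.1 hγ r hrq))
  have coset_unique (x : G) (hfx : pullback Γl η p f (ξ * x⁻¹) ≠ 0)
      (hgx : pullback Γl η q g x ≠ 0) : γ * x⁻¹ ∈ Γ := by
    have hx := support_pullback_subset g hgx
    have hξx := mem_unramifiedOutside.1 (support_pullback_subset f hfx) q hpq.symm
    refine (h.mem_gamma_iff_of_mem_unramifiedOutside (mul_mem hγ (inv_mem hx))).2 ?_
    simpa [mul_assoc] using mul_mem hγq hξx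
  rw [(h.isHeckeFun_pullback hf).conv_eq_mul (h.isHeckeFun_pullback hg) coset_unique,
    pullback_of_mem f hξγ, pullback_of_mem g hγ, map_mul, map_inv,
    hf.right_inv _ (inv_mem (mem_unramifiedOutside.1 hγ p hpq)), ← hg.left_inv _ hγq (η q ξ),
    inv_mul_cancel_right]

lemma support_conv_pullback_subset (p q : ι) (f : Gl p → ℤ) (g : Gl q → ℤ) :
    (conv Γ (pullback Γl η p f) (pullback Γl η q g)).support ⊆
      unramifiedOutside Γl η {p, q} := by
  have mono {r : ι} (hr : r ∈ ({p, q} : Set ι)) :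
      unramifiedOutside Γl η {r} ≤ unramifiedOutside Γl η {p, q} := fun _ hg =>
    mem_unramifiedOutside.2 fun s hs => mem_unramifiedOutside.1 hg s fun hsr => hs (hsr ▸ hr)
  exact support_conv_subset ((support_pullback_subset f).trans (mono (by simp)))
    ((support_pullback_subset g).trans (mono (by simp)))

lemma conv_pullback_comm (h : IsLocalGlobal Δ Γ Δl Γl η) {p q : ι} (hpq : p ≠ q) {f : Gl p → ℤ}
    {g : Gl q → ℤ} (hf : IsHeckeFun (Δl p) (Γl p) f) (hg : IsHeckeFun (Δl q) (Γl q) g) :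
    conv Γ (pullback Γl η p f) (pullback Γl η q g) =
      conv Γ (pullback Γl η q g) (pullback Γl η p f) := by
  funext ξ
  by_cases hξ : ξ ∈ unramifiedOutside Γl η {p, q}
  · rw [h.conv_pullback_of_ne hpq hf hg hξ, mul_comm,
      h.conv_pullback_of_ne hpq.symm hg hf (Set.pair_comm p q ▸ hξ)]
  · rw [Function.notMem_support.1 fun hne => hξ (support_conv_pullback_subset p q f g hne),
      Function.notMem_support.1 fun hne =>
        hξ (Set.pair_comm q p ▸ support_conv_pullback_subset q p g f hne)]

variable [IsHeckeTriple Δ Γ Γ]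

lemma support_toFun_one_subset (h : IsLocalGlobal Δ Γ Δl Γl η) (S : Set ι) :
    (toFun (1 : HeckeRing Δ Γ ℤ)).support ⊆ unramifiedOutside Γl η S := by
  classical
  intro g hg
  rw [Function.mem_support, toFun_one] at hg
  exact h.gamma_le_unramifiedOutside S (ite_ne_right_iff.1 hg).1

variable [∀ p, IsHeckeTriple (Δl p) (Γl p) (Γl p)]

lemma eqOn_toFun_one (h : IsLocalGlobal Δ Γ Δl Γl η) (p : ι) :
    Set.EqOn (toFun (1 : HeckeRing Δ Γ ℤ)) (toFun (1 : HeckeRing (Δl p) (Γl p) ℤ) ∘ η p)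
      (unramifiedOutside Γl η {p}) := by
  classical
  intro g hg
  rw [Function.comp_apply, toFun_one, toFun_one]
  exact if_congr (h.mem_gamma_iff_of_mem_unramifiedOutside hg) rfl rfl

/-- The homomorphism from the local Hecke ring at `p` to the global Hecke ring. -/
def localHom (h : IsLocalGlobal Δ Γ Δl Γl η) (p : ι) :
    HeckeRing (Δl p) (Γl p) ℤ →+* HeckeRing Δ Γ ℤ where
  toFun x := ofFun (pullback Γl η p (toFun x)) (h.isHeckeFun_pullback (isHeckeFun_toFun x))
  map_one' := toFun_injective <| by
    rw [toFun_ofFun]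
    exact (eq_pullback (h.support_toFun_one_subset {p}) (h.eqOn_toFun_one p)).symm
  map_mul' x y := toFun_injective <| by
    rw [toFun_ofFun, toFun_mul, toFun_mul, toFun_ofFun, toFun_ofFun]
    exact (h.conv_pullback (isHeckeFun_toFun x) (isHeckeFun_toFun y)).symm
  map_zero' := toFun_injective <| by
    rw [toFun_ofFun, toFun_zero, toFun_zero]
    exact Set.indicator_zero ℤ _
  map_add' x y := toFun_injective <| by
    rw [toFun_ofFun, toFun_add, toFun_add, toFun_ofFun, toFun_ofFun]
    exact Set.indicator_add _ (toFun x ∘ η p) (toFun y ∘ η p)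

lemma toFun_localHom (h : IsLocalGlobal Δ Γ Δl Γl η) (p : ι) (x : HeckeRing (Δl p) (Γl p) ℤ) :
    toFun (h.localHom p x) = pullback Γl η p (toFun x) :=
  toFun_ofFun _ (h.isHeckeFun_pullback (isHeckeFun_toFun x))

lemma localHom_injective (h : IsLocalGlobal Δ Γ Δl Γl η) (p : ι) :
    Function.Injective (h.localHom p) := by
  intro x y hxy
  refine toFun_injective (funext fun g => ?_)
  obtain ⟨γ, hγ, hγg⟩ := h.exists_global p g
  have eq_at_γ := congrFun (congrArg toFun hxy) γ
  rw [toFun_localHom, toFun_localHom, pullback_of_mem _ hγ, pullback_of_mem _ hγ] at eq_at_γ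
  rw [← (isHeckeFun_toFun x).left_inv _ hγg, ← (isHeckeFun_toFun y).left_inv _ hγg]
  simpa using eq_at_γ

lemma commute_localHom (h : IsLocalGlobal Δ Γ Δl Γl η) {p q : ι} (hpq : p ≠ q)
    (x : HeckeRing (Δl p) (Γl p) ℤ) (y : HeckeRing (Δl q) (Γl q) ℤ) :
    Commute (h.localHom p x) (h.localHom q y) := by
  refine toFun_injective ?_
  rw [toFun_mul, toFun_mul, toFun_localHom, toFun_localHom]
  exact h.conv_pullback_comm hpq (isHeckeFun_toFun x) (isHeckeFun_toFun y)

/-- The elements of the global Hecke ring whose values on the elements unramified outside `p` come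
from the local Hecke ring at `p`. -/
def localSubring (h : IsLocalGlobal Δ Γ Δl Γl η) (p : ι) : Subring (HeckeRing Δ Γ ℤ) where
  carrier := {x | ∃ y : HeckeRing (Δl p) (Γl p) ℤ,
    Set.EqOn (toFun x) (toFun y ∘ η p) (unramifiedOutside Γl η {p})}
  zero_mem' := ⟨0, fun g _ => by simp [toFun_zero]⟩
  one_mem' := ⟨1, h.eqOn_toFun_one p⟩
  add_mem' := by
    rintro x x' ⟨y, hy⟩ ⟨y', hy'⟩
    exact ⟨y + y', fun g hg => by simp [toFun_add, hy hg, hy' hg]⟩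
  neg_mem' := by
    rintro x ⟨y, hy⟩
    exact ⟨-y, fun g hg => by simp [toFun_neg, hy hg]⟩
  mul_mem' := by
    rintro x x' ⟨y, hy⟩ ⟨y', hy'⟩
    refine ⟨y * y', ?_⟩
    rw [toFun_mul, toFun_mul]
    exact h.eqOn_conv (isHeckeFun_toFun x).supp (isHeckeFun_toFun x').supp
      (isHeckeFun_toFun y) (isHeckeFun_toFun y') hy hy'

lemma localHom_mem_localSubring (h : IsLocalGlobal Δ Γ Δl Γl η) (p q : ι)
    (x : HeckeRing (Δl q) (Γl q) ℤ) : h.localHom q x ∈ h.localSubring p := by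
  classical
  rcases eq_or_ne q p with rfl | hqp
  · exact ⟨x, fun g hg => by rw [toFun_localHom, pullback_of_mem _ hg, Function.comp_apply]⟩
  · -- the elements unramified outside `p` and outside `q` are those of `Γ`
    refine ⟨toFun x 1 • 1, fun g hg => ?_⟩
    rw [toFun_localHom, Function.comp_apply, toFun_zsmul, Pi.smul_apply, toFun_one]
    by_cases hgp : η p g ∈ Γl p
    · have hgΓ := (h.mem_gamma_iff_of_mem_unramifiedOutside hg).2 hgp
      rw [pullback_of_mem _ (h.gamma_le_unramifiedOutside _ hgΓ), if_pos hgp,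
        ← (isHeckeFun_toFun x).left_inv _ ((h.mem_gamma_iff g).1 hgΓ q) 1, mul_one, smul_eq_mul,
        mul_one]
    · rw [pullback_of_notMem _ fun hg' => hgp (mem_unramifiedOutside.1 hg' p hqp.symm),
        if_neg hgp, smul_zero]

theorem iSup_range_localHom_ne_top (h : IsLocalGlobal Δ Γ Δl Γl η) {p : ι} {ξ ξ' : G} (hξΔ : ξ ∈ Δ)
    (hξ : ξ ∈ unramifiedOutside Γl η {p}) (hξ' : ξ' ∈ unramifiedOutside Γl η {p})
    (hlocal : η p ξ' ∈ DoubleCoset.doubleCoset (η p ξ) (Γl p) (Γl p))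
    (hglobal : ξ' ∉ DoubleCoset.doubleCoset ξ Γ Γ) :
    (⨆ p, (h.localHom p).range) ≠ ⊤ := by
  classical
  intro htop
  have hle : (⨆ p, (h.localHom p).range) ≤ h.localSubring p := iSup_le fun q => by
    rintro _ ⟨x, rfl⟩
    exact h.localHom_mem_localSubring p q x
  rw [htop] at hle
  obtain ⟨y, hy⟩ := hle (Subring.mem_top (basis Γ (⟨ξ, hξΔ⟩ : Δ)))
  obtain ⟨a, ha, b, hb, hab⟩ := DoubleCoset.mem_doubleCoset.1 hlocal
  have toFun_basis_eq : toFun (basis Γ (⟨ξ, hξΔ⟩ : Δ)) ξ' = toFun (basis Γ (⟨ξ, hξΔ⟩ : Δ)) ξ := by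
    rw [hy hξ, hy hξ', Function.comp_apply, Function.comp_apply, hab,
      (isHeckeFun_toFun y).right_inv b hb, (isHeckeFun_toFun y).left_inv a ha]
  rw [toFun_basis, toFun_basis, if_neg hglobal,
    if_pos (DoubleCoset.mem_doubleCoset_self Γ Γ ξ)] at toFun_basis_eq
  exact zero_ne_one toFun_basis_eq

end IsLocalGlobal

end HeckePair

namespace LieAut

open HeckePair

variable (L : Type*) [LieRing L]

/-- The local-global principle for the automorphisms of a Lie ring over `ℤ`, with the completions
at all primes as localizations. -/
def HasLocalGlobal : Prop :=
  IsLocalGlobal (Gl := fun p : Nat.Primes => LieAut ℚ_[p] (ℚ_[p] ⊗[ℤ] L))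
    (Delta ℤ ℚ L) (Gamma ℤ ℚ L) (fun p => Delta ℤ_[p] ℚ_[p] L) (fun p => Gamma ℤ_[p] ℚ_[p] L)
    (fun p => extendScalars ℚ_[p])

variable {L}

lemma eta_mem_gammaHat_iff (h : HasLocalGlobal L) (g : LieAut ℚ (ℚ ⊗[ℤ] L)) :
    eta L g ∈ GammaHat L ↔ g ∈ Gamma ℤ ℚ L :=
  (h.mem_gamma_iff g).symm

lemma mulSingle_mem_gammaHat {p : Nat.Primes} {c : LieAut ℚ_[p] (ℚ_[p] ⊗[ℤ] L)}
    (hc : c ∈ Gamma ℤ_[p] ℚ_[p] L) : (Pi.mulSingle p c : ProdGroup L) ∈ GammaHat L := by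
  intro q
  rcases eq_or_ne q p with rfl | hq
  · simpa only [Pi.mulSingle_eq_same] using hc
  · simp only [Pi.mulSingle_eq_of_ne hq, one_mem]

lemma eta_mem_doubleCoset_localIncl_iff (p : Nat.Primes) (α : Delta ℤ_[p] ℚ_[p] L)
    (β : LieAut ℚ (ℚ ⊗[ℤ] L)) :
    eta L β ∈ DoubleCoset.doubleCoset (localIncl L p α : ProdGroup L) (GammaHat L) (GammaHat L) ↔
      (∀ q : Nat.Primes, q ≠ p → extendScalars ℚ_[q] β ∈ Gamma ℤ_[q] ℚ_[q] L) ∧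
      extendScalars ℚ_[p] β ∈ DoubleCoset.doubleCoset (α : LieAut ℚ_[p] (ℚ_[p] ⊗[ℤ] L))
        (Gamma ℤ_[p] ℚ_[p] L) (Gamma ℤ_[p] ℚ_[p] L) := by
  have localIncl_eq : (localIncl L p α : ProdGroup L) = Pi.mulSingle p α.1 := rfl
  rw [DoubleCoset.mem_doubleCoset, DoubleCoset.mem_doubleCoset, localIncl_eq]
  constructor
  · rintro ⟨a, ha, b, hb, hab⟩
    refine ⟨fun q hq => ?_, a p, ha p, b p, hb p, ?_⟩
    · have hab_q : extendScalars ℚ_[q] β = a q * (Pi.mulSingle p α.1 : ProdGroup L) q * b q :=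
        congrFun hab q
      rw [hab_q, Pi.mulSingle_eq_of_ne hq, mul_one]
      exact mul_mem (ha q) (hb q)
    · have hab_p : extendScalars ℚ_[p] β = a p * (Pi.mulSingle p α.1 : ProdGroup L) p * b p :=
        congrFun hab p
      rw [hab_p, Pi.mulSingle_eq_same]
  · rintro ⟨hβ, a, ha, b, hb, hab⟩
    have away_from_p : eta L β * (Pi.mulSingle p (extendScalars ℚ_[p] β))⁻¹ ∈ GammaHat L := by
      intro q
      rw [Pi.mul_apply, Pi.inv_apply]
      rcases eq_or_ne q p with rfl | hq
      · rw [Pi.mulSingle_eq_same]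
        exact (mul_inv_cancel (extendScalars ℚ_[q] β)).symm ▸ one_mem _
      · rw [Pi.mulSingle_eq_of_ne hq, inv_one, mul_one]
        exact hβ q hq
    refine ⟨eta L β * (Pi.mulSingle p (extendScalars ℚ_[p] β))⁻¹ * Pi.mulSingle p a,
      ?_, Pi.mulSingle p b, mulSingle_mem_gammaHat hb, ?_⟩
    · exact mul_mem away_from_p (mulSingle_mem_gammaHat ha)
    · rw [hab, Pi.mulSingle_mul, Pi.mulSingle_mul]
      group

lemma localMap_basis (p : Nat.Primes) (α : Delta ℤ_[p] ℚ_[p] L) :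
    localMap L p (basis (Gamma ℤ_[p] ℚ_[p] L) α) = basis (GammaHat L) (localIncl L p α) :=
  Finsupp.mapDomain_single

lemma etaStar_basis (α : DeltaHat L) :
    etaStar L (basis (GammaHat L) α) =
      ∑ᶠ E ∈ etaFiber L (HeckeCoset.mk _ _ α),
        (HeckeCosetModule.of (Finsupp.single E 1) : GlobalHeckeRing L) := by
  unfold etaStar basis
  refine (Finsupp.liftAddHom_apply_single (M := ℤ) (N := GlobalHeckeRing L) _ _ _).trans ?_
  rw [zmultiplesHom_apply, one_zsmul]

section EtaFiber

variable [IsHeckeTriple (DeltaHat L) (GammaHat L) (GammaHat L)]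

lemma mk_mem_etaFiber_iff (h : HasLocalGlobal L) (α : DeltaHat L) (β : Delta ℤ ℚ L) :
    HeckeCoset.mk (Gamma ℤ ℚ L) (Gamma ℤ ℚ L) β ∈ etaFiber L (HeckeCoset.mk _ _ α) ↔
      eta L β ∈ DoubleCoset.doubleCoset (α : ProdGroup L) (GammaHat L) (GammaHat L) := by
  rw [DoubleCoset.mem_doubleCoset]
  constructor
  · rintro ⟨β', ⟨α', hα', hmk⟩, hmk'⟩
    obtain ⟨a, ha, b, hb, hab⟩ := mk_eq_mk.1 hmk.symm
    obtain ⟨c, hc, d, hd, hcd⟩ := mk_eq_mk.1 hmk'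
    refine ⟨eta L c * a, mul_mem ((eta_mem_gammaHat_iff h c).2 hc) ha, b * eta L d,
      mul_mem hb ((eta_mem_gammaHat_iff h d).2 hd), ?_⟩
    rw [hcd, map_mul, map_mul, ← hα', hab]
    group
  · rintro ⟨a, ha, b, hb, hab⟩
    have hβ : eta L β ∈ DeltaHat L := by
      rw [hab]
      exact mul_mem (mul_mem (IsHeckeTriple.mem_of_mem_left (GammaHat L) ha) α.2)
        (IsHeckeTriple.mem_of_mem_left (GammaHat L) hb)
    exact ⟨β, ⟨⟨eta L β, hβ⟩, rfl, (mk_eq_mk.2 ⟨a, ha, b, hb, hab⟩).symm⟩, rfl⟩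

lemma finite_etaFiber (h : HasLocalGlobal L)
    (D : HeckeCoset (DeltaHat L) (GammaHat L) (GammaHat L)) : (etaFiber L D).Finite := by
  obtain ⟨α, rfl⟩ := Quotient.exists_rep D
  let rep (E : HeckeCoset (Delta ℤ ℚ L) (Gamma ℤ ℚ L) (Gamma ℤ ℚ L)) : Delta ℤ ℚ L := E.out
  have mk_rep (E) : HeckeCoset.mk (Gamma ℤ ℚ L) (Gamma ℤ ℚ L) (rep E) = E := Quotient.out_eq E
  let toCoset (E) : Cosets (GammaHat L) :=
    Quotient.mk (QuotientGroup.rightRel (GammaHat L)) (eta L (rep E))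
  have toCoset_injective : Function.Injective toCoset := by
    intro D E hDE
    have hDE' := QuotientGroup.rightRel_apply.1 (Quotient.exact hDE)
    rw [← map_inv, ← map_mul, eta_mem_gammaHat_iff h] at hDE'
    rw [← mk_rep D, ← mk_rep E]
    exact mk_eq_mk.2 ⟨_, hDE', 1, one_mem _, by simp⟩
  refine Set.Finite.of_finite_image (f := toCoset) ?_ toCoset_injective.injOn
  refine (finite_cosets (IsHeckeTriple.mem_commensurator_right (GammaHat L) α)).subset ?_
  rintro _ ⟨E, hE, rfl⟩
  rw [← mk_rep E] at hE
  obtain ⟨a, ha, b, hb, hab⟩ :=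
    DoubleCoset.mem_doubleCoset.1 ((mk_mem_etaFiber_iff h α (rep E)).1 hE)
  obtain ⟨c, hc, hout⟩ := out_mk (GammaHat L) (eta L (rep E))
  refine ⟨c * a, mul_mem hc ha, b, hb, ?_⟩
  rw [hout, hab]
  group

end EtaFiber

variable [Module.Finite ℤ L]

lemma localHom_eq_etaStar (h : HasLocalGlobal L) (p : Nat.Primes) (x : LocalHeckeRing L p) :
    IsLocalGlobal.localHom h p x = etaStar L (localMap L p x) := by
  classical
  suffices (IsLocalGlobal.localHom h p : LocalHeckeRing L p →+ GlobalHeckeRing L) =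
      (etaStar L).comp (localMap L p) from DFunLike.congr_fun this x
  refine addHom_ext fun α => toFun_injective (funext fun ξ => ?_)
  rw [AddMonoidHom.comp_apply, localMap_basis, etaStar_basis]
  refine (congrFun (IsLocalGlobal.toFun_localHom h p (basis _ α)) ξ).trans ?_
  by_cases hξ : ξ ∈ Delta ℤ ℚ L
  · have mem_fiber_iff := (mk_mem_etaFiber_iff h (localIncl L p α) ⟨ξ, hξ⟩).trans
      (eta_mem_doubleCoset_localIncl_iff p α ξ)
    have toFun_etaStar := toFun_finsum_mem_single
      (finite_etaFiber h (HeckeCoset.mk _ _ (localIncl L p α))) ⟨ξ, hξ⟩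
    rw [toFun_etaStar, if_congr mem_fiber_iff rfl rfl, ite_and, pullback, Set.indicator_apply,
      Function.comp_apply, toFun_basis]
    exact if_congr mem_unramifiedOutside rfl rfl
  · rw [toFun, dif_neg hξ]
    exact Function.notMem_support.1 fun hne =>
      hξ ((IsLocalGlobal.isHeckeFun_pullback h (isHeckeFun_toFun _)).supp ξ hne)

end LieAut

namespace Heisenberg

lemma heisenbergIdeal_le_ker {M : Type*} [LieRing M] (hM : ∀ a b c : M, ⁅a, ⁅b, c⁆⁆ = 0)
    (f : FreeLieAlgebra ℤ (Fin 2) →ₗ⁅ℤ⁆ M) : heisenbergIdeal ≤ f.ker := by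
  have derived_le : ⁅(⊤ : LieIdeal ℤ (FreeLieAlgebra ℤ (Fin 2))),
      (⊤ : LieIdeal ℤ (FreeLieAlgebra ℤ (Fin 2)))⁆ ≤ (LieAlgebra.center ℤ M).comap f := by
    refine (LieSubmodule.lie_le_iff _ _ _).2 fun b _ c _ => ?_
    rw [LieIdeal.mem_comap, LieHom.map_lie, LieModule.mem_maxTrivSubmodule]
    exact fun a => hM a _ _
  refine (LieSubmodule.lie_le_iff _ _ _).2 fun a _ v hv => ?_
  rw [LieHom.mem_ker, LieHom.map_lie]
  exact (LieModule.mem_maxTrivSubmodule ℤ M M _).1 (LieIdeal.mem_comap.1 (derived_le hv)) (f a)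

section StrictUpper

attribute [local instance] LieRing.ofAssociativeRing

/-- The Lie algebra of strictly upper triangular integer `3 × 3` matrices, a concrete model of the
Heisenberg Lie algebra. -/
def strictUpper : LieSubalgebra ℤ (Matrix (Fin 3) (Fin 3) ℤ) where
  carrier := {M | ∀ i j, j ≤ i → M i j = 0}
  zero_mem' _ _ _ := rfl
  add_mem' hM hN i j hij := by simp [hM i j hij, hN i j hij]
  smul_mem' n M hM i j hij := by simp [hM i j hij]
  lie_mem' {M N} hM hN i j hij := by
    rw [Ring.lie_def, Matrix.sub_apply, Matrix.mul_apply, Matrix.mul_apply,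
      Finset.sum_eq_zero, Finset.sum_eq_zero, sub_zero]
    all_goals
      intro k _
      rcases le_total k i with hk | hk
      · simp [hM i k hk, hN i k hk]
      · simp [hM k j (hij.trans hk), hN k j (hij.trans hk)]

lemma strictUpper_lie_lie (a b c : strictUpper) : ⁅a, ⁅b, c⁆⁆ = 0 := by
  obtain ⟨a, ha⟩ := a
  obtain ⟨b, hb⟩ := b
  obtain ⟨c, hc⟩ := c
  have lower {M : Matrix (Fin 3) (Fin 3) ℤ} (hM : M ∈ strictUpper) : M 0 0 = 0 ∧ M 1 0 = 0 ∧
      M 1 1 = 0 ∧ M 2 0 = 0 ∧ M 2 1 = 0 ∧ M 2 2 = 0 :=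
    ⟨hM _ _ le_rfl, hM _ _ (by decide), hM _ _ le_rfl, hM _ _ (by decide), hM _ _ (by decide),
      hM _ _ le_rfl⟩
  refine Subtype.ext (Matrix.ext fun i j => ?_)
  simp only [LieSubalgebra.coe_bracket, Ring.lie_def]
  fin_cases i <;> fin_cases j <;>
    simp [Matrix.mul_apply, Fin.sum_univ_three, lower ha, lower hb, lower hc]

/-- The homomorphism from the free Lie algebra that sends the generators to the elementary matrices
above the diagonal. -/
def freeToStrictUpper : FreeLieAlgebra ℤ (Fin 2) →ₗ⁅ℤ⁆ strictUpper :=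
  FreeLieAlgebra.lift ℤ fun i => ⟨Matrix.single i.castSucc i.succ 1, fun j k hkj =>
    Matrix.single_apply_of_ne _ _ _ _ _ <| by
      rintro ⟨rfl, rfl⟩
      exact absurd (Fin.castSucc_lt_succ (i := i)) (not_lt.2 hkj)⟩

lemma freeToStrictUpper_of (i : Fin 2) : (freeToStrictUpper (FreeLieAlgebra.of ℤ i) :
    Matrix (Fin 3) (Fin 3) ℤ) = Matrix.single i.castSucc i.succ 1 :=
  congrArg Subtype.val (FreeLieAlgebra.lift_of_apply _ i)

/-- The generators of the Heisenberg Lie algebra and their bracket. -/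
def basisVec : Fin 3 → Heisenberg := ![gen 0, gen 1, ⁅gen 0, gen 1⁆]

lemma freeToStrictUpper_combination (a b c : ℤ) :
    (freeToStrictUpper (a • FreeLieAlgebra.of ℤ 0 + b • FreeLieAlgebra.of ℤ 1 +
      c • ⁅FreeLieAlgebra.of ℤ (0 : Fin 2), FreeLieAlgebra.of ℤ (1 : Fin 2)⁆) :
        Matrix (Fin 3) (Fin 3) ℤ) = !![0, a, c; 0, 0, b; 0, 0, 0] := by
  rw [map_add, map_add, map_smul, map_smul, map_smul, LieHom.map_lie]
  simp only [AddMemClass.coe_add, SetLike.val_smul, LieSubalgebra.coe_bracket,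
    freeToStrictUpper_of]
  ext i j
  fin_cases i <;> fin_cases j <;> simp [Ring.lie_def]

lemma linearIndependent_basisVec : LinearIndependent ℤ basisVec := by
  rw [Fintype.linearIndependent_iff]
  intro c hc
  have proj_eq_zero : proj (c 0 • FreeLieAlgebra.of ℤ 0 + c 1 • FreeLieAlgebra.of ℤ 1 +
      c 2 • ⁅FreeLieAlgebra.of ℤ (0 : Fin 2), FreeLieAlgebra.of ℤ (1 : Fin 2)⁆) = 0 := by
    rw [map_add, map_add, map_smul, map_smul, map_smul, LieHom.map_lie]
    rwa [Fin.sum_univ_three] at hc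
  have matrix_eq_zero := congrArg Subtype.val (LieHom.mem_ker.1
    (heisenbergIdeal_le_ker strictUpper_lie_lie freeToStrictUpper
      ((LieSubmodule.Quotient.mk_eq_zero' (N := heisenbergIdeal)).1 proj_eq_zero)))
  rw [freeToStrictUpper_combination] at matrix_eq_zero
  have entry_eq_zero := congrFun₂ matrix_eq_zero
  rw [Fin.forall_fin_succ, Fin.forall_fin_two]
  exact ⟨entry_eq_zero 0 1, entry_eq_zero 1 2, entry_eq_zero 0 2⟩

end StrictUpper

lemma gen_mem_spanSubalgebra (i : Fin 2) : gen i ∈ spanSubalgebra := by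
  change gen i ∈ Submodule.span ℤ {gen 0, gen 1, ⁅gen 0, gen 1⁆}
  fin_cases i <;> exact Submodule.subset_span (by simp)

lemma spanSubalgebra_eq_top : spanSubalgebra = ⊤ := by
  let F : FreeLieAlgebra ℤ (Fin 2) →ₗ⁅ℤ⁆ spanSubalgebra :=
    FreeLieAlgebra.lift ℤ fun i => ⟨gen i, gen_mem_spanSubalgebra i⟩
  have incl_comp_F : spanSubalgebra.incl.comp F = proj := by
    refine FreeLieAlgebra.hom_ext fun i => ?_
    change (F (FreeLieAlgebra.of ℤ i) : Heisenberg) = gen i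
    exact congrArg Subtype.val (FreeLieAlgebra.lift_of_apply
      (fun i => (⟨gen i, gen_mem_spanSubalgebra i⟩ : spanSubalgebra)) i)
  refine eq_top_iff.2 fun u _ => ?_
  obtain ⟨x, rfl⟩ := proj_surjective u
  rw [← incl_comp_F]
  exact (F x).2

lemma span_range_basisVec : Submodule.span ℤ (Set.range basisVec) = ⊤ := by
  have range_basisVec : Set.range basisVec = {gen 0, gen 1, ⁅gen 0, gen 1⁆} := by
    simp only [basisVec, Matrix.range_cons, Matrix.range_empty, Set.union_empty,
      Set.singleton_union]
  rw [range_basisVec]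
  exact congrArg LieSubalgebra.toSubmodule spanSubalgebra_eq_top

/-- The `ℤ`-basis of the Heisenberg Lie algebra formed by the generators and their bracket. -/
def zbasis : Module.Basis (Fin 3) ℤ Heisenberg :=
  Module.Basis.mk linearIndependent_basisVec span_range_basisVec.ge

section Field

variable (K : Type*) [Field K]

/-- The extension of `zbasis` to a basis over `K`. -/
def kbasis : Module.Basis (Fin 3) K (K ⊗[ℤ] Heisenberg) := Algebra.TensorProduct.basis K zbasis

lemma kbasis_apply (i : Fin 3) : kbasis K i = 1 ⊗ₜ[ℤ] basisVec i := by
  rw [kbasis, Algebra.TensorProduct.basis_apply, zbasis, Module.Basis.mk_apply]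

variable {K}

lemma kbasis_repr_tmul (a : K) (x : Heisenberg) (j : Fin 3) :
    (kbasis K).repr (a ⊗ₜ[ℤ] x) j = a * (zbasis.repr x j : K) := by
  simp [kbasis, Algebra.TensorProduct.basis_repr_tmul]

lemma lie_kbasis_zero_one : ⁅kbasis K 0, kbasis K 1⁆ = kbasis K 2 := by
  rw [kbasis_apply, kbasis_apply, kbasis_apply, LieAlgebra.ExtendScalars.bracket_tmul, mul_one]
  rfl

lemma lie_kbasis_two (v : K ⊗[ℤ] Heisenberg) : ⁅v, kbasis K 2⁆ = 0 := by
  rw [kbasis_apply]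
  induction v with
  | zero => exact zero_lie _
  | tmul a x =>
    rw [LieAlgebra.ExtendScalars.bracket_tmul]
    exact (congrArg _ (lie_lie_eq_zero x (gen 0) (gen 1))).trans (TensorProduct.tmul_zero _ _)
  | add v w hv hw => rw [add_lie, hv, hw, add_zero]

lemma lie_eq (v w : K ⊗[ℤ] Heisenberg) : ⁅v, w⁆ =
    ((kbasis K).repr v 0 * (kbasis K).repr w 1 - (kbasis K).repr v 1 * (kbasis K).repr w 0) •
      kbasis K 2 := by
  have two_lie (u : K ⊗[ℤ] Heisenberg) : ⁅kbasis K 2, u⁆ = 0 := by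
    rw [← lie_skew, lie_kbasis_two, neg_zero]
  have one_lie_zero : ⁅kbasis K 1, kbasis K 0⁆ = -kbasis K 2 := by
    rw [← lie_skew, lie_kbasis_zero_one]
  conv_lhs => rw [← (kbasis K).sum_repr v, ← (kbasis K).sum_repr w]
  simp only [Fin.sum_univ_three, add_lie, lie_add, smul_lie, lie_smul, lie_self, two_lie,
    lie_kbasis_two, lie_kbasis_zero_one, one_lie_zero]
  module

/-- The matrix of an automorphism, acting on row vectors. -/
def mat (g : LieAut K (K ⊗[ℤ] Heisenberg)) : Matrix (Fin 3) (Fin 3) K :=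
  Matrix.of fun i j => (kbasis K).repr (g (kbasis K i)) j

lemma repr_apply (g : LieAut K (K ⊗[ℤ] Heisenberg)) (v : K ⊗[ℤ] Heisenberg) (j : Fin 3) :
    (kbasis K).repr (g v) j = ∑ i, (kbasis K).repr v i * mat g i j := by
  have apply_eq_sum : g v = ∑ i, (kbasis K).repr v i • g (kbasis K i) := by
    conv_lhs => rw [← (kbasis K).sum_repr v]
    refine (map_sum g.toLieEquiv _ _).trans (Finset.sum_congr rfl fun i _ => ?_)
    exact map_smul g.toLieEquiv _ _
  rw [apply_eq_sum, map_sum, Finsupp.finsetSum_apply]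
  simp [mat]

lemma mat_mul (g h : LieAut K (K ⊗[ℤ] Heisenberg)) : mat (g * h) = mat g * mat h := by
  ext i j
  rw [Matrix.mul_apply]
  exact repr_apply h (g (kbasis K i)) j

lemma mat_one : mat (1 : LieAut K (K ⊗[ℤ] Heisenberg)) = 1 := by
  ext i j
  simp [mat, LieAut.one_apply, Finsupp.single_apply, Matrix.one_apply]

lemma mat_injective : Function.Injective (mat : LieAut K (K ⊗[ℤ] Heisenberg) → _) := by
  intro g h mat_eq
  ext v
  refine (kbasis K).ext_elem fun j => ?_
  rw [repr_apply, repr_apply, mat_eq]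

lemma apply_kbasis_two (g : LieAut K (K ⊗[ℤ] Heisenberg)) :
    g (kbasis K 2) = (mat g 0 0 * mat g 1 1 - mat g 0 1 * mat g 1 0) • kbasis K 2 := by
  conv_lhs => rw [← lie_kbasis_zero_one]
  exact (LieEquiv.map_lie g.toLieEquiv _ _).trans (lie_eq _ _)

lemma mat_two_zero (g : LieAut K (K ⊗[ℤ] Heisenberg)) : mat g 2 0 = 0 := by
  simp [mat, apply_kbasis_two]

lemma mat_two_one (g : LieAut K (K ⊗[ℤ] Heisenberg)) : mat g 2 1 = 0 := by
  simp [mat, apply_kbasis_two]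

lemma mat_two_two (g : LieAut K (K ⊗[ℤ] Heisenberg)) :
    mat g 2 2 = mat g 0 0 * mat g 1 1 - mat g 0 1 * mat g 1 0 := by
  conv_lhs => rw [mat, Matrix.of_apply, apply_kbasis_two]
  simp

lemma mat_two_two_mul_inv (g : LieAut K (K ⊗[ℤ] Heisenberg)) :
    mat g 2 2 * mat g⁻¹ 2 2 = 1 := by
  have entry_eq := congrFun₂ (mat_mul g g⁻¹) 2 2
  rw [mul_inv_cancel, mat_one, Matrix.mul_apply, Fin.sum_univ_three, mat_two_zero, mat_two_one,
    zero_mul, zero_mul, zero_add, zero_add] at entry_eq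
  exact entry_eq.symm

lemma mat_two_two_ne_zero (g : LieAut K (K ⊗[ℤ] Heisenberg)) : mat g 2 2 ≠ 0 :=
  left_ne_zero_of_mul_eq_one (mat_two_two_mul_inv g)

/-- The matrix of the automorphism of the Heisenberg Lie algebra that maps the first two basis
vectors to `(a, b, u)` and `(c, d, v)`; their bracket is scaled by `a * d - b * c`. -/
def autMatrix {R : Type*} [CommRing R] (a b c d u v : R) : Matrix (Fin 3) (Fin 3) R :=
  !![a, b, u; c, d, v; 0, 0, a * d - b * c]

lemma autMatrix_mul {R : Type*} [CommRing R] (a b c d u v a' b' c' d' u' v' : R) :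
    autMatrix a b c d u v * autMatrix a' b' c' d' u' v' =
      autMatrix (a * a' + b * c') (a * b' + b * d') (c * a' + d * c') (c * b' + d * d')
        (a * u' + b * v' + u * (a' * d' - b' * c'))
        (c * u' + d * v' + v * (a' * d' - b' * c')) := by
  ext i j
  rw [Matrix.mul_apply, Fin.sum_univ_three]
  fin_cases i <;> fin_cases j <;> simp [autMatrix]
  ring

lemma autMatrix_map {R S : Type*} [CommRing R] [CommRing S] (f : R →+* S) (a b c d u v : R) :
    (autMatrix a b c d u v).map f = autMatrix (f a) (f b) (f c) (f d) (f u) (f v) := by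
  ext i j
  fin_cases i <;> fin_cases j <;> simp [autMatrix]

lemma det_autMatrix {R : Type*} [CommRing R] (a b c d u v : R) :
    (autMatrix a b c d u v).det = (a * d - b * c) ^ 2 := by
  simp [autMatrix, Matrix.det_fin_three]
  ring

lemma mat_eq_autMatrix (g : LieAut K (K ⊗[ℤ] Heisenberg)) : mat g =
    autMatrix (mat g 0 0) (mat g 0 1) (mat g 1 0) (mat g 1 1) (mat g 0 2) (mat g 1 2) := by
  ext i j
  fin_cases i <;> fin_cases j <;>
    simp [autMatrix, mat_two_zero, mat_two_one, mat_two_two]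

lemma det_mat (g : LieAut K (K ⊗[ℤ] Heisenberg)) : (mat g).det = mat g 2 2 ^ 2 := by
  rw [mat_two_two, ← det_autMatrix _ _ _ _ (mat g 0 2) (mat g 1 2), ← mat_eq_autMatrix]

/-- The linear automorphism that acts on row vectors by `autMatrix a b c d u v`. -/
def linearEquivOfCoeffs (a b c d u v : K) (h : a * d - b * c ≠ 0) :
    K ⊗[ℤ] Heisenberg ≃ₗ[K] K ⊗[ℤ] Heisenberg :=
  Matrix.toLinearEquiv (kbasis K) (autMatrix a b c d u v).transpose <| by
    rw [Matrix.det_transpose, det_autMatrix, isUnit_iff_ne_zero]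
    exact pow_ne_zero 2 h

lemma repr_linearEquivOfCoeffs {a b c d u v : K} (h : a * d - b * c ≠ 0)
    (x : K ⊗[ℤ] Heisenberg) (j : Fin 3) :
    (kbasis K).repr (linearEquivOfCoeffs a b c d u v h x) j =
      ∑ i, (kbasis K).repr x i * autMatrix a b c d u v i j :=
  (congrFun (Matrix.repr_toLin (kbasis K) (kbasis K) _ x) j).trans <|
    congrFun (Matrix.mulVec_transpose _ _) j

lemma linearEquivOfCoeffs_kbasis_two {a b c d u v : K} (h : a * d - b * c ≠ 0) :
    linearEquivOfCoeffs a b c d u v h (kbasis K 2) = (a * d - b * c) • kbasis K 2 := by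
  refine (kbasis K).ext_elem fun j => ?_
  rw [repr_linearEquivOfCoeffs, Fin.sum_univ_three]
  fin_cases j <;> simp [autMatrix]

/-- The Lie algebra automorphism with matrix `autMatrix a b c d u v`. -/
def ofCoeffs (a b c d u v : K) (h : a * d - b * c ≠ 0) : LieAut K (K ⊗[ℤ] Heisenberg) :=
  ⟨{ linearEquivOfCoeffs a b c d u v h with
      map_lie' := fun {x y} => by
        change linearEquivOfCoeffs a b c d u v h ⁅x, y⁆ =
          ⁅linearEquivOfCoeffs a b c d u v h x, linearEquivOfCoeffs a b c d u v h y⁆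
        rw [lie_eq, lie_eq, map_smul, linearEquivOfCoeffs_kbasis_two, smul_smul]
        congr 1
        simp only [repr_linearEquivOfCoeffs, Fin.sum_univ_three, autMatrix, Matrix.of_apply,
          Matrix.cons_val]
        ring }⟩

lemma mat_ofCoeffs {a b c d u v : K} (h : a * d - b * c ≠ 0) :
    mat (ofCoeffs a b c d u v h) = autMatrix a b c d u v := by
  ext i j
  refine (repr_linearEquivOfCoeffs h _ j).trans ?_
  simp [Finsupp.single_apply]

lemma mem_lattice_iff {R : Type*} [CommRing R] [Algebra R K] (x : K ⊗[ℤ] Heisenberg) :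
    x ∈ LieAut.lattice R K Heisenberg ↔ ∀ j, (kbasis K).repr x j ∈ (algebraMap R K).range := by
  constructor
  · intro hx j
    induction hx using Submodule.span_induction with
    | mem v hv =>
      obtain ⟨y, rfl⟩ := hv
      rw [kbasis_repr_tmul, one_mul]
      exact intCast_mem _ _
    | zero => simp
    | add v w _ _ hv hw =>
      rw [map_add, Finsupp.add_apply]
      exact add_mem hv hw
    | smul r v _ hv =>
      rw [← algebraMap_smul K r v, map_smul, Finsupp.smul_apply, smul_eq_mul]
      exact mul_mem ⟨r, rfl⟩ hv
  · intro h
    rw [← (kbasis K).sum_repr x]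
    refine Submodule.sum_mem _ fun j _ => ?_
    obtain ⟨r, hr⟩ := h j
    rw [← hr, algebraMap_smul, kbasis_apply]
    exact Submodule.smul_mem _ _ (Submodule.subset_span ⟨_, rfl⟩)

lemma mem_delta_iff {R : Type*} [CommRing R] [Algebra R K] (g : LieAut K (K ⊗[ℤ] Heisenberg)) :
    g ∈ LieAut.Delta R K Heisenberg ↔ ∀ i j, mat g i j ∈ (algebraMap R K).range := by
  constructor
  · intro hg i
    refine (mem_lattice_iff (R := R) (g (kbasis K i))).1 (hg _ ?_)
    rw [kbasis_apply]
    exact Submodule.subset_span ⟨_, rfl⟩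
  · intro h x hx
    rw [mem_lattice_iff] at hx ⊢
    intro j
    rw [repr_apply]
    exact sum_mem fun i _ => mul_mem (hx i) (h i j)

lemma mem_gamma_iff {R : Type*} [CommRing R] [Algebra R K] [FaithfulSMul R K]
    (g : LieAut K (K ⊗[ℤ] Heisenberg)) : g ∈ LieAut.Gamma R K Heisenberg ↔
      g ∈ LieAut.Delta R K Heisenberg ∧ ∃ r : R, IsUnit r ∧ algebraMap R K r = mat g 2 2 := by
  constructor
  · rintro ⟨hg, hg'⟩
    obtain ⟨r, hr⟩ := (mem_delta_iff g).1 hg 2 2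
    obtain ⟨s, hs⟩ := (mem_delta_iff g⁻¹).1 hg' 2 2
    refine ⟨hg, r, IsUnit.of_mul_eq_one s (FaithfulSMul.algebraMap_injective R K ?_), hr⟩
    rw [map_mul, hr, hs, mat_two_two_mul_inv, map_one]
  · rintro ⟨hg, r, hr, hgr⟩
    choose N hN using (mem_delta_iff g).1 hg
    have map_N : (algebraMap R K).mapMatrix (Matrix.of N) = mat g := Matrix.ext hN
    have isUnit_det : IsUnit (Matrix.of N).det := by
      have det_eq : (Matrix.of N).det = r ^ 2 := FaithfulSMul.algebraMap_injective R K <| by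
        rw [RingHom.map_det, map_N, det_mat, ← hgr, map_pow]
      rw [det_eq]
      exact hr.pow 2
    have mat_inv : mat g⁻¹ = (algebraMap R K).mapMatrix (Matrix.of N)⁻¹ := by
      refine left_inv_eq_right_inv (a := mat g) ?_ ?_
      · rw [← mat_mul, inv_mul_cancel, mat_one]
      · rw [← map_N, ← map_mul, Matrix.mul_nonsing_inv _ isUnit_det, map_one]
    refine ⟨hg, (mem_delta_iff _).2 fun i j => ?_⟩
    rw [mat_inv]
    exact ⟨_, rfl⟩

lemma repr_scalarMap {K' : Type*} [Field K'] [Algebra K K'] (v : K ⊗[ℤ] Heisenberg) (j : Fin 3) :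
    (kbasis K').repr (LieAut.scalarMap K K' Heisenberg v) j =
      algebraMap K K' ((kbasis K).repr v j) := by
  induction v with
  | zero => simp
  | tmul a x => rw [LieAut.scalarMap_tmul, kbasis_repr_tmul, kbasis_repr_tmul, map_mul, map_intCast]
  | add v w hv hw => simp only [map_add, Finsupp.add_apply, hv, hw]

lemma mat_extendScalars {K' : Type*} [Field K'] [Algebra K K']
    (g : LieAut K (K ⊗[ℤ] Heisenberg)) :
    mat (LieAut.extendScalars K' g) = (mat g).map (algebraMap K K') := by
  ext i j
  have extendScalars_kbasis : LieAut.extendScalars K' g (kbasis K' i) =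
      LieAut.scalarMap K K' Heisenberg (g (kbasis K i)) := by
    rw [kbasis_apply, kbasis_apply]
    exact (LieAut.extendLinear_tmul K' _ _ _).trans (one_smul _ _)
  rw [mat, Matrix.of_apply, extendScalars_kbasis, repr_scalarMap]
  rfl

end Field

end Heisenberg

lemma mem_range_algebraMap_int_iff {r : ℚ} :
    r ∈ (algebraMap ℤ ℚ).range ↔ ∀ p : Nat.Primes, ‖(r : ℚ_[p])‖ ≤ 1 := by
  constructor
  · rintro ⟨n, rfl⟩ p
    rw [eq_intCast, Rat.cast_intCast]
    exact Padic.norm_int_le_one n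
  · refine fun h => ⟨r.num, Rat.coe_int_num_of_den_eq_one ?_⟩
    by_contra hden
    obtain ⟨p, hp, hpden⟩ := Nat.exists_prime_and_dvd hden
    have : Fact p.Prime := ⟨hp⟩
    exact Rat.padicValuation_le_one_iff.1
      ((Padic.norm_rat_le_one_iff_padicValuation_le_one p).1 (h ⟨p, hp⟩)) hpden

lemma mem_range_algebraMap_padicInt_iff {p : ℕ} [Fact p.Prime] {x : ℚ_[p]} :
    x ∈ (algebraMap ℤ_[p] ℚ_[p]).range ↔ ‖x‖ ≤ 1 :=
  ⟨fun ⟨y, hy⟩ => hy ▸ y.2, fun h => ⟨⟨x, h⟩, rfl⟩⟩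

lemma norm_natCast_prime_of_ne {p q : Nat.Primes} (h : q ≠ p) : ‖((p : ℕ) : ℚ_[q])‖ = 1 :=
  Padic.norm_natCast_eq_one_iff.2 <|
    (Nat.coprime_primes q.2 p.2).2 fun e => h (Subtype.ext e)

/-- Strong approximation for `ℤ[1/p]` in `ℚ_p`. -/
lemma exists_rat_norm_sub_lt (p : Nat.Primes) (z : ℚ_[p]) {ε : ℝ} (hε : 0 < ε) :
    ∃ r : ℚ, (∀ q : Nat.Primes, q ≠ p → ‖(r : ℚ_[q])‖ ≤ 1) ∧ ‖z - r‖ < ε := by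
  have p_pow_pos (n : ℕ) : 0 < ‖((p : ℕ) : ℚ_[p]) ^ n‖ :=
    norm_pos_iff.2 (pow_ne_zero n (Nat.cast_ne_zero.2 p.2.ne_zero))
  obtain ⟨n, hn⟩ := pow_unbounded_of_one_lt ‖z‖ (Nat.one_lt_cast.2 p.2.one_lt : (1 : ℝ) < p)
  have norm_mul_le_one : ‖((p : ℕ) : ℚ_[p]) ^ n * z‖ ≤ 1 := by
    rw [norm_mul, norm_pow, Padic.norm_p, inv_pow,
      inv_mul_le_iff₀ (pow_pos (Nat.cast_pos.2 p.2.pos) n), mul_one]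
    exact hn.le
  obtain ⟨w, hw⟩ : ∃ w : ℤ_[p], (w : ℚ_[p]) = (p : ℕ) ^ n * z := ⟨⟨_, norm_mul_le_one⟩, rfl⟩
  obtain ⟨m, hm⟩ := PadicInt.denseRange_natCast.exists_dist_lt w (mul_pos hε (p_pow_pos n))
  refine ⟨m / (p : ℕ) ^ n, fun q hq => ?_, ?_⟩
  · push_cast
    rw [norm_div, norm_pow, norm_natCast_prime_of_ne hq, one_pow, div_one]
    exact Padic.norm_int_le_one (m : ℤ)
  · rw [dist_eq_norm, PadicInt.norm_def, PadicInt.coe_sub, PadicInt.coe_natCast, hw] at hm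
    push_cast
    rw [← mul_lt_mul_iff_left₀ (p_pow_pos n), ← norm_mul, sub_mul,
      div_mul_cancel₀ _ (norm_pos_iff.1 (p_pow_pos n)), mul_comm z]
    exact hm

lemma exists_rat_norm_mul_add_le_one {p : Nat.Primes} {x : ℚ_[p]} (hx : x ≠ 0) (y : ℚ_[p]) :
    ∃ r : ℚ, (∀ q : Nat.Primes, q ≠ p → ‖(r : ℚ_[q])‖ ≤ 1) ∧ ‖x * r + y‖ ≤ 1 := by
  obtain ⟨r, hr, hr'⟩ := exists_rat_norm_sub_lt p (-(y / x)) (inv_pos.2 (norm_pos_iff.2 hx))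
  refine ⟨r, hr, ?_⟩
  have eq_mul : x * r + y = -x * (-(y / x) - r) := by
    field_simp
    ring
  rw [eq_mul, norm_mul, norm_neg]
  exact ((lt_inv_mul_iff₀ (norm_pos_iff.2 hx)).1 (by rwa [mul_one])).le

lemma exists_rat_norm_mul_eq_one {p : Nat.Primes} {x : ℚ_[p]} (hx : x ≠ 0) :
    ∃ r : ℚ, (∀ q : Nat.Primes, q ≠ p → ‖(r : ℚ_[q])‖ = 1) ∧ ‖x * r‖ = 1 := by
  refine ⟨(p : ℕ) ^ (-x.valuation), fun q hq => ?_, ?_⟩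
  · push_cast
    rw [norm_zpow, norm_natCast_prime_of_ne hq, one_zpow]
  · push_cast
    rw [norm_mul, Padic.norm_p_zpow, Padic.norm_eq_zpow_neg_valuation hx,
      ← zpow_add₀ (Nat.cast_ne_zero.2 p.2.ne_zero), add_neg_cancel, zpow_zero]

lemma exists_rowReduction {K : Type*} [NormedField K] (x y : K) :
    ∃ a b c d : K, ‖a‖ ≤ 1 ∧ ‖b‖ ≤ 1 ∧ ‖c‖ ≤ 1 ∧ ‖d‖ ≤ 1 ∧ ‖a * d - b * c‖ = 1 ∧
      c * x + d * y = 0 := by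
  have norm_neg_div_le_one {s t : K} (h : ‖t‖ ≤ ‖s‖) : ‖-(t / s)‖ ≤ 1 := by
    rw [norm_neg, norm_div]
    exact div_le_one_of_le₀ h (norm_nonneg _)
  have neg_div_mul_self_add {s t : K} (h : ‖t‖ ≤ ‖s‖) : -(t / s) * s + t = 0 := by
    rcases eq_or_ne s 0 with rfl | hs
    · simpa using h
    · rw [neg_mul, div_mul_cancel₀ _ hs, neg_add_cancel]
  rcases le_total ‖y‖ ‖x‖ with h | h
  · exact ⟨1, 0, -(y / x), 1, by simp, by simp, norm_neg_div_le_one h, by simp, by simp,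
      by rw [one_mul, neg_div_mul_self_add h]⟩
  · exact ⟨0, 1, 1, -(x / y), by simp, by simp, by simp, norm_neg_div_le_one h, by simp,
      by rw [one_mul, add_comm, neg_div_mul_self_add h]⟩

namespace Heisenberg

open LieAut HeckePair

section Padic

variable {p : ℕ} [Fact p.Prime] {g : LieAut ℚ_[p] (ℚ_[p] ⊗[ℤ] Heisenberg)}

lemma mem_delta_padic_iff : g ∈ Delta ℤ_[p] ℚ_[p] Heisenberg ↔ ∀ i j, ‖mat g i j‖ ≤ 1 := by
  simp only [mem_delta_iff, mem_range_algebraMap_padicInt_iff]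

lemma mem_gamma_padic_iff : g ∈ Gamma ℤ_[p] ℚ_[p] Heisenberg ↔
    (∀ i j, ‖mat g i j‖ ≤ 1) ∧ ‖mat g 2 2‖ = 1 := by
  rw [mem_gamma_iff, mem_delta_padic_iff]
  refine and_congr_right fun hg => ⟨?_, fun h => ⟨⟨_, hg 2 2⟩, PadicInt.isUnit_iff.2 h, rfl⟩⟩
  rintro ⟨r, hr, hgr⟩
  rw [← hgr]
  exact PadicInt.isUnit_iff.1 hr

lemma mem_gamma_padic_of_mat_eq {a b c d u v : ℚ_[p]} (hg : mat g = autMatrix a b c d u v)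
    (ha : ‖a‖ ≤ 1) (hb : ‖b‖ ≤ 1) (hc : ‖c‖ ≤ 1) (hd : ‖d‖ ≤ 1) (hu : ‖u‖ ≤ 1) (hv : ‖v‖ ≤ 1)
    (hdet : ‖a * d - b * c‖ = 1) : g ∈ Gamma ℤ_[p] ℚ_[p] Heisenberg := by
  rw [mem_gamma_padic_iff, hg]
  refine ⟨fun i j => ?_, hdet⟩
  fin_cases i <;> fin_cases j <;> simp [autMatrix, *]

variable (g) in
lemma exists_mem_gamma_mat_mul_one_zero :
    ∃ γ ∈ Gamma ℤ_[p] ℚ_[p] Heisenberg, mat (γ * g) 1 0 = 0 := by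
  obtain ⟨a, b, c, d, ha, hb, hc, hd, hdet, reduce⟩ := exists_rowReduction (mat g 0 0) (mat g 1 0)
  have det_ne_zero : a * d - b * c ≠ 0 := norm_ne_zero_iff.1 (hdet ▸ one_ne_zero)
  refine ⟨ofCoeffs a b c d 0 0 det_ne_zero, mem_gamma_padic_of_mat_eq (mat_ofCoeffs _) ha hb hc hd
    (by simp) (by simp) hdet, ?_⟩
  rw [mat_mul, mat_ofCoeffs, mat_eq_autMatrix g, autMatrix_mul]
  exact reduce

end Padic

lemma mem_delta_iff_forall_prime (g : LieAut ℚ (ℚ ⊗[ℤ] Heisenberg)) : g ∈ Delta ℤ ℚ Heisenberg ↔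
    ∀ p : Nat.Primes, extendScalars ℚ_[p] g ∈ Delta ℤ_[p] ℚ_[p] Heisenberg := by
  simp only [mem_delta_iff (R := ℤ), mem_delta_padic_iff, mat_extendScalars, Matrix.map_apply,
    eq_ratCast, mem_range_algebraMap_int_iff]
  exact ⟨fun h p i j => h i j p, fun h i j p => h p i j⟩

lemma exists_mul_extendScalars_mem_gamma_of_upper {p : Nat.Primes}
    {g : LieAut ℚ_[p] (ℚ_[p] ⊗[ℤ] Heisenberg)} {a b d u v : ℚ_[p]}
    (hg : mat g = autMatrix a b 0 d u v) :
    ∃ h ∈ unramifiedOutside (fun q : Nat.Primes => Gamma ℤ_[q] ℚ_[q] Heisenberg)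
        (fun q => extendScalars (K := ℚ) (L := Heisenberg) ℚ_[q]) {p},
      g * extendScalars ℚ_[p] h ∈ Gamma ℤ_[p] ℚ_[p] Heisenberg := by
  have diag_ne_zero : a * d ≠ 0 := by simpa [hg, autMatrix] using mat_two_two_ne_zero g
  have ha := left_ne_zero_of_mul diag_ne_zero
  have hd := right_ne_zero_of_mul diag_ne_zero
  obtain ⟨α, hα, haα⟩ := exists_rat_norm_mul_eq_one ha
  obtain ⟨δ, hδ, hdδ⟩ := exists_rat_norm_mul_eq_one hd
  obtain ⟨β, hβ, hβ'⟩ := exists_rat_norm_mul_add_le_one ha (b * δ)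
  obtain ⟨ν, hν, hν'⟩ := exists_rat_norm_mul_add_le_one hd (v * (α * δ))
  obtain ⟨μ, hμ, hμ'⟩ := exists_rat_norm_mul_add_le_one ha (b * ν + u * (α * δ))
  have det_ne_zero : α * δ - β * 0 ≠ 0 := by
    have hα0 : α ≠ 0 := by
      rintro rfl
      simp at haα
    have hδ0 : δ ≠ 0 := by
      rintro rfl
      simp at hdδ
    rw [mul_zero, sub_zero]
    exact mul_ne_zero hα0 hδ0
  have mat_extend (q : Nat.Primes) := (mat_extendScalars (K' := ℚ_[q])
    (ofCoeffs α β 0 δ μ ν det_ne_zero)).trans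
      ((congrArg (Matrix.map · _) (mat_ofCoeffs _)).trans (autMatrix_map _ _ _ _ _ _ _))
  simp only [eq_ratCast, Rat.cast_zero] at mat_extend
  refine ⟨ofCoeffs α β 0 δ μ ν det_ne_zero, mem_unramifiedOutside.2 fun q hq => ?_, ?_⟩
  · exact mem_gamma_padic_of_mat_eq (mat_extend q) (hα q hq).le (hβ q hq) (by simp) (hδ q hq).le
      (hμ q hq) (hν q hq) (by simp [hα q hq, hδ q hq])
  · refine mem_gamma_padic_of_mat_eq (a := a * α) (b := a * β + b * δ) (c := 0)
      (d := d * δ) (u := a * μ + (b * ν + u * (α * δ)))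
      (v := d * ν + v * (α * δ)) ?_ haα.le hβ' (by simp) hdδ.le hμ' hν' (by simp [haα, hdδ])
    rw [mat_mul, hg, mat_extend, autMatrix_mul]
    simp only [mul_zero, zero_mul, zero_add, add_zero, sub_zero, add_assoc]

theorem hasLocalGlobal : HasLocalGlobal Heisenberg where
  mem_gamma_iff g := by
    refine (and_congr (mem_delta_iff_forall_prime g) (mem_delta_iff_forall_prime g⁻¹)).trans ?_
    simp only [map_inv]
    exact forall_and.symm
  mem_delta_iff := mem_delta_iff_forall_prime
  mem_local_iff _ _ := Iff.rfl
  exists_global p g := by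
    obtain ⟨γ, hγ, upper⟩ := exists_mem_gamma_mat_mul_one_zero g
    have mat_eq := mat_eq_autMatrix (γ * g)
    rw [upper] at mat_eq
    obtain ⟨h, hh, mul_mem_gamma⟩ := exists_mul_extendScalars_mem_gamma_of_upper mat_eq
    refine ⟨h⁻¹, inv_mem hh, ?_⟩
    rw [map_inv]
    simpa [mul_assoc] using mul_mem (inv_mem mul_mem_gamma) hγ

lemma exists_int_coeffs_of_mem_gamma {g : LieAut ℚ (ℚ ⊗[ℤ] Heisenberg)}
    (hg : g ∈ Gamma ℤ ℚ Heisenberg) : ∃ a b c d u v : ℤ,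
      mat g = (autMatrix a b c d u v).map (algebraMap ℤ ℚ) ∧ IsUnit (a * d - b * c) := by
  obtain ⟨hgΔ, r, hr, hgr⟩ := (mem_gamma_iff g).1 hg
  choose N hN using (mem_delta_iff g).1 hgΔ
  have det_eq : N 0 0 * N 1 1 - N 0 1 * N 1 0 = r := by
    rw [mat_two_two, ← hN, ← hN, ← hN, ← hN] at hgr
    exact_mod_cast hgr.symm
  refine ⟨N 0 0, N 0 1, N 1 0, N 1 1, N 0 2, N 1 2, ?_, det_eq ▸ hr⟩
  rw [autMatrix_map, hN, hN, hN, hN, hN, hN]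
  exact mat_eq_autMatrix g

lemma autMatrix_inj {R : Type*} [CommRing R] {a b c d u v a' b' c' d' u' v' : R}
    (h : autMatrix a b c d u v = autMatrix a' b' c' d' u' v') :
    a = a' ∧ b = b' ∧ c = c' ∧ d = d' ∧ u = u' ∧ v = v' :=
  ⟨congrFun₂ h 0 0, congrFun₂ h 0 1, congrFun₂ h 1 0, congrFun₂ h 1 1, congrFun₂ h 0 2,
    congrFun₂ h 1 2⟩

/-- The matrix equation forces `p ∣ c`, `a ≡ D` and `d * w' ≡ D * w` modulo `p`, where
`D = a * d - b * c`; hence `D * w' ≡ a * d * w' ≡ D * (D * w)`. -/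
lemma dvd_of_autMatrix_mul_eq {R : Type*} [CommRing R] [IsDomain R]
    {p w w' a b c d u v a' b' c' d' u' v' : R} (hp : p ≠ 0)
    (h : autMatrix a b c d u v * autMatrix p 0 0 (p ^ 3) 1 (p * w') =
      autMatrix p 0 0 (p ^ 3) 1 (p * w) * autMatrix a' b' c' d' u' v') :
    p ∣ (a * d - b * c) * (w' - (a * d - b * c) * w) := by
  rw [autMatrix_mul, autMatrix_mul] at h
  obtain ⟨h00, h01, h10, h11, h02, h12⟩ := autMatrix_inj h
  obtain rfl : a' = a := mul_left_cancel₀ hp (by linear_combination -h00)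
  obtain rfl : b' = p ^ 2 * b := mul_left_cancel₀ hp (by linear_combination -h01)
  obtain rfl : c = p ^ 2 * c' := mul_left_cancel₀ hp (by linear_combination h10)
  obtain rfl : d' = d := mul_left_cancel₀ (pow_ne_zero 3 hp) (by linear_combination -h11)
  set D := a' * d' - b * (p ^ 2 * c') with hD
  have a_eq : a' = D + p * (u' - b * w' - u * p ^ 3) := by linear_combination h02
  have d_mul_eq : d' * w' = D * w + p * (p * v' - p ^ 2 * v - c') :=
    mul_left_cancel₀ hp (by linear_combination h12)
  refine ⟨(u' - b * w' - u * p ^ 3) * (D * w) + a' * (p * v' - p ^ 2 * v - c') -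
    p * b * c' * w', ?_⟩
  linear_combination w' * hD + D * w * a_eq + a' * d_mul_eq

/-- For `w` a unit modulo `p`, the local double coset of `witness p w` at `p` does not depend on
`w`, but the global one determines `w` modulo `p` up to sign. -/
def witness (p : Nat.Primes) (w : ℤ) : LieAut ℚ (ℚ ⊗[ℤ] Heisenberg) :=
  ofCoeffs (p : ℚ) 0 0 (p ^ 3) 1 (p * w) (by simp [p.2.ne_zero])

lemma mat_witness (p : Nat.Primes) (w : ℤ) :
    mat (witness p w) = (autMatrix (p : ℤ) 0 0 (p ^ 3) 1 (p * w)).map (algebraMap ℤ ℚ) := by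
  rw [witness, mat_ofCoeffs, autMatrix_map]
  simp

lemma mat_extendScalars_witness (p q : Nat.Primes) (w : ℤ) :
    mat (extendScalars ℚ_[q] (witness p w)) = autMatrix (p : ℚ_[q]) 0 0 (p ^ 3) 1 (p * w) := by
  simp [mat_extendScalars, witness, mat_ofCoeffs, autMatrix_map]

lemma witness_mem_delta (p : Nat.Primes) (w : ℤ) : witness p w ∈ Delta ℤ ℚ Heisenberg := by
  rw [mem_delta_iff, mat_witness]
  exact fun i j => ⟨_, rfl⟩

lemma witness_mem_unramifiedOutside (p : Nat.Primes) (w : ℤ) : witness p w ∈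
    unramifiedOutside (fun q : Nat.Primes => Gamma ℤ_[q] ℚ_[q] Heisenberg)
      (fun q => extendScalars (K := ℚ) (L := Heisenberg) ℚ_[q]) {p} := by
  refine mem_unramifiedOutside.2 fun q hq => ?_
  have norm_p : ‖((p : ℕ) : ℚ_[q])‖ = 1 := norm_natCast_prime_of_ne hq
  exact mem_gamma_padic_of_mat_eq (mat_extendScalars_witness p q w) norm_p.le (by simp) (by simp)
    (by simp [norm_p]) (by simp) (by simpa [norm_p] using Padic.norm_int_le_one w)
    (by simp [norm_p])

variable {p : Nat.Primes} {w w' : ℤ}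

lemma extendScalars_witness_mem_doubleCoset (hw : ¬ (p : ℤ) ∣ w) (hw' : ¬ (p : ℤ) ∣ w') :
    extendScalars ℚ_[p] (witness p w') ∈ DoubleCoset.doubleCoset (extendScalars ℚ_[p] (witness p w))
      (Gamma ℤ_[p] ℚ_[p] Heisenberg) (Gamma ℤ_[p] ℚ_[p] Heisenberg) := by
  have norm_eq_one {n : ℤ} (hn : ¬ (p : ℤ) ∣ n) : ‖(n : ℚ_[p])‖ = 1 :=
    (Padic.norm_int_le_one n).antisymm (not_lt.1 (Padic.norm_intCast_lt_one_iff.not.2 hn))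
  have cast_ne_zero {n : ℤ} (hn : ¬ (p : ℤ) ∣ n) : (n : ℚ_[p]) ≠ 0 :=
    norm_ne_zero_iff.1 (norm_eq_one hn ▸ one_ne_zero)
  have exists_scaling {s t : ℤ} (hs : ¬ (p : ℤ) ∣ s) (ht : ¬ (p : ℤ) ∣ t) :
      ∃ γ ∈ Gamma ℤ_[p] ℚ_[p] Heisenberg, mat γ = autMatrix (s / t : ℚ_[p]) 0 0 1 0 0 := by
    have det_ne_zero : (s / t : ℚ_[p]) * 1 - 0 * 0 ≠ 0 := by
      rw [mul_one, mul_zero, sub_zero]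
      exact div_ne_zero (cast_ne_zero hs) (cast_ne_zero ht)
    exact ⟨_, mem_gamma_padic_of_mat_eq (mat_ofCoeffs det_ne_zero)
      (by simp [norm_eq_one, hs, ht]) (by simp) (by simp) (by simp) (by simp) (by simp)
      (by simp [norm_eq_one, hs, ht]), mat_ofCoeffs det_ne_zero⟩
  obtain ⟨γ, hγ, mat_γ⟩ := exists_scaling hw hw'
  obtain ⟨δ, hδ, mat_δ⟩ := exists_scaling hw' hw
  refine DoubleCoset.mem_doubleCoset.2 ⟨γ, hγ, δ, hδ, mat_injective ?_⟩
  have := cast_ne_zero hw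
  have := cast_ne_zero hw'
  simp only [mat_mul, mat_γ, mat_δ, mat_extendScalars_witness, autMatrix_mul]
  congr 1 <;> field_simp <;> ring

lemma witness_notMem_doubleCoset (hsub : ¬ (p : ℤ) ∣ w' - w) (hadd : ¬ (p : ℤ) ∣ w' + w) :
    witness p w' ∉ DoubleCoset.doubleCoset (witness p w) (Gamma ℤ ℚ Heisenberg)
      (Gamma ℤ ℚ Heisenberg) := by
  rw [DoubleCoset.mem_doubleCoset]
  rintro ⟨g, hg, h, hh, eq_mul⟩
  obtain ⟨a, b, c, d, u, v, mat_g, isUnit_det⟩ := exists_int_coeffs_of_mem_gamma (inv_mem hg)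
  obtain ⟨a', b', c', d', u', v', mat_h, -⟩ := exists_int_coeffs_of_mem_gamma hh
  have mat_mul_eq : mat (g⁻¹ * witness p w') = mat (witness p w * h) := by
    rw [eq_mul, mul_assoc, inv_mul_cancel_left]
  rw [mat_mul, mat_mul, mat_g, mat_h, mat_witness, mat_witness, ← Matrix.map_mul,
    ← Matrix.map_mul] at mat_mul_eq
  have dvd := dvd_of_autMatrix_mul_eq (Int.natCast_ne_zero.2 p.2.ne_zero)
    (Matrix.map_injective (algebraMap ℤ ℚ).injective_int mat_mul_eq)
  rw [isUnit_det.dvd_mul_left] at dvd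
  rcases Int.isUnit_iff.1 isUnit_det with det_eq | det_eq <;> rw [det_eq] at dvd
  · exact hsub (by simpa using dvd)
  · exact hadd (by simpa using dvd)

end Heisenberg

end

theorem theorem4p6 :
    ∃ φ : ∀ p : Nat.Primes,
        LieAut.LocalHeckeRing Heisenberg p →+* LieAut.GlobalHeckeRing Heisenberg,
      -- each local Hecke ring embeds into the global one by `η^*`
      (∀ p x, φ p x = LieAut.etaStar Heisenberg (LieAut.localMap Heisenberg p x)) ∧
      (∀ p, Function.Injective (φ p)) ∧
      -- the local Hecke rings commute with each other
      (∀ p q, p ≠ q → ∀ x y, Commute (φ p x) (φ q y)) ∧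
      -- the local Hecke rings do not generate the global one as a ring
      (⨆ p, (φ p).range) ≠ ⊤ := by
  have h := Heisenberg.hasLocalGlobal
  refine ⟨h.localHom, LieAut.localHom_eq_etaStar h, h.localHom_injective,
    fun p q hpq => h.commute_localHom hpq, ?_⟩
  exact h.iSup_range_localHom_ne_top (p := ⟨5, Nat.prime_five⟩) (Heisenberg.witness_mem_delta _ 1)
    (Heisenberg.witness_mem_unramifiedOutside _ 1) (Heisenberg.witness_mem_unramifiedOutside _ 2)
    (Heisenberg.extendScalars_witness_mem_doubleCoset (by decide) (by decide))
    (Heisenberg.witness_notMem_doubleCoset (by decide) (by decide))
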